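/- Let $d\ge 1$, let $\sigma$ be surface measure ($d$-dimensional Hausdorff measure) on the unit sphere $\mathbb S^d\subset\mathbb R^{d+1}$, and write $$\mathcal E f(x)=\int_{\mathbb S^d}e^{ix\cdot\omega}f(\omega)\,d\sigma(\omega),\qquad x\in\mathbb R^{d+1},\qquad S_{p\to q}:=\sup_{\|f\|_{L^p(\mathbb S^d)}=1}\|\mathcal E f\|_{L^q(\mathbb R^{d+1})}\in[0,\infty],$$ for $(p,q)\in[1,\infty]^2$; let $p'$ be the exponent dual to $p$. Say that the extension conjecture holds at $(p,q)\in[1,\infty]^2$ if $S_{p\to q}<\infty$, or $q\le\frac{2(d+1)}d$, or $q<\frac{d+2}d p'$. Theorem. Let $(p,q)\in[1,\infty]^2$ satisfy $q>\max\{p,\frac{d+2}d p'\}$, and assume that the extension conjecture holds at every point of some neighborhood of $(p,q)$ in $[1,\infty]^2$. Let $(f_n)$ be a sequence in $L^p(\mathbb S^d)$ with $\|f_n\|_{L^p}=1$ for all $n$ which is extremizing, i.e. $\lim_{n\to\infty}\|\mathcal E f_n\|_{L^q}/\|f_n\|_{L^p}=S_{p\to q}$. Then there is a sequence $(x_n)$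 in $\mathbb R^{d+1}$ such that $\{e^{ix_n\cdot\omega}f_n : n\in\mathbb N\}$ is precompact (has compact closure) in $L^p(\mathbb S^d)$. Moreover, extremizers exist: there is a nonzero $f\in L^p(\mathbb S^d)$ with $\|\mathcal E f\|_{L^q(\mathbb R^{d+1})}=S_{p\to q}\|f\|_{L^p(\mathbb S^d)}$. -/

import Mathlib

open MeasureTheory Filter Topology
open scoped ENNReal

noncomputable section

namespace SphereExtension

/-- The ambient Euclidean space `ℝ^{d+1}`. -/
abbrev Space (d : ℕ) : Type := EuclideanSpace ℝ (Fin (d + 1))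

/-- The unit sphere `S^d` in `ℝ^{d+1}`. -/
abbrev Sph (d : ℕ) : Type := Metric.sphere (0 : Space d) 1

/-- Surface measure on `S^d`, i.e. the (classically normalized) `d`-dimensional Hausdorff measure;
`σ(S^d) = (d + 1) |B|` with `B` the unit ball of `ℝ^{d+1}`. -/
def surf (d : ℕ) : Measure (Sph d) := (volume : Measure (Space d)).toSphere

/-- The character `ω ↦ e^{i x·ω}` on `S^d`. -/
def character {d : ℕ} (x : Space d) (ω : Sph d) : ℂ :=
  Complex.exp (Complex.I * (inner ℝ x (ω : Space d) : ℝ))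

/-- The extension operator `ℰ f(x) = ∫_{S^d} e^{i x·ω} f(ω) dσ(ω)`. As `σ` is finite, the integral
converges absolutely for each `f ∈ L^p(S^d)`, `1 ≤ p ≤ ∞`. -/
def extend {d : ℕ} (f : Sph d → ℂ) (x : Space d) : ℂ :=
  ∫ ω, character x ω * f ω ∂(surf d)

/-- The operator norm `S_{p → q}` of `ℰ : L^p(S^d) → L^q(ℝ^{d+1})`, possibly `∞`. -/
def opNorm (d : ℕ) (p q : ℝ≥0∞) : ℝ≥0∞ :=
  ⨆ (f : Sph d → ℂ) (_ : MemLp f p (surf d)) (_ : eLpNorm f p (surf d) = 1),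
    eLpNorm (extend f) q volume

/-- The number `(d+2)/d · p'` with `p'` the exponent dual to `p`. -/
def scalingExponent (d : ℕ) (p : ℝ≥0∞) : ℝ≥0∞ :=
  ((d : ℝ≥0∞) + 2) / d * p.conjExponent

/-- The extension conjecture holds at `(p, q)`: the extension operator is bounded from `L^p` to
`L^q`, or `(p, q)` is outside of the conjectured range. -/
def ExtensionConjectureAt (d : ℕ) (p q : ℝ≥0∞) : Prop :=
  opNorm d p q < ∞ ∨ q ≤ 2 * ((d : ℝ≥0∞) + 1) / d ∨ q < scalingExponent d p

/-- The extension conjecture holds on a neighborhood of `(p, q)` in `[1, ∞]²`. -/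
def ExtensionConjectureNear (d : ℕ) (p q : ℝ≥0∞) : Prop :=
  ∀ᶠ rs : ℝ≥0∞ × ℝ≥0∞ in 𝓝[Set.Icc 1 ∞ ×ˢ Set.Icc 1 ∞] (p, q),
    ExtensionConjectureAt d rs.1 rs.2

/-- The sequence `f` is extremizing: `‖ℰ f_n‖_q / ‖f_n‖_p → S_{p → q}`. -/
def IsExtremizing {d : ℕ} (p q : ℝ≥0∞) (f : ℕ → Lp ℂ p (surf d)) : Prop :=
  Tendsto (fun n => eLpNorm (extend (f n)) q volume / eLpNorm (f n) p (surf d)) atTop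
    (𝓝 (opNorm d p q))

/-- A nonzero `f` with `‖ℰ f‖_q = S_{p → q} ‖f‖_p`. -/
def IsExtremizer {d : ℕ} (p q : ℝ≥0∞) (f : Lp ℂ p (surf d)) : Prop :=
  f ≠ 0 ∧ eLpNorm (extend f) q volume = opNorm d p q * eLpNorm f p (surf d)

theorem continuous_character {d : ℕ} (x : Space d) : Continuous (character x) := by
  unfold character
  fun_prop

theorem norm_character {d : ℕ} (x : Space d) (ω : Sph d) : ‖character x ω‖ = 1 := by
  rw [character, mul_comm]
  exact Complex.norm_exp_ofReal_mul_I _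

theorem memLp_character_mul {d : ℕ} {p : ℝ≥0∞} (x : Space d) (f : Lp ℂ p (surf d)) :
    MemLp (fun ω => character x ω * f ω) p (surf d) := by
  have hf : MemLp (f : Sph d → ℂ) p (surf d) := Lp.memLp f
  refine hf.of_le ((continuous_character x).aestronglyMeasurable.mul hf.1) ?_
  exact Eventually.of_forall fun ω => by rw [norm_mul, norm_character, one_mul]

/-- The modulation `f ↦ e^{i x·ω} f(ω)` on `L^p(S^d)`. Its effect on `ℰ f` is a translation. -/
def modulate {d : ℕ} {p : ℝ≥0∞} (x : Space d) (f : Lp ℂ p (surf d)) : Lp ℂ p (surf d) :=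
  (memLp_character_mul x f).toLp (fun ω => character x ω * f ω)

end SphereExtension

end

/-!
The extremizing sequence `f_n` is studied along an arbitrary ultrafilter `U` on `ℕ`, along which all
bounded scalar sequences converge, so that no subsequences have to be extracted. Put `F_n = ℰ f_n`
and `S = S_{p → q}`.

*Profiles.* The conjecture near `(p, q)` bounds `ℰ` from `L^p` to `L^q` and to `L^s` for some
`s < q`. The `F_n` are therefore bounded in `L^s` and equi-Lipschitz, so the sets `{|F_n| ≥ δ}` are
covered by a bounded number of unit balls (`exists_card_cover`), and for `q < ∞` little of the `L^q`
norm lives outside of them. Centers whose difference stays bounded along `U` are put into one class;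
sequences `y_j` from different classes diverge from one another. Weak convergence in `L^p(S^d)`
gives locally uniform convergence of the extensions, so the weak limits `φ_j` of the modulations
`e^{i y_j·ω} f_n` account for almost all of `‖F_n‖_q ^ q`: up to `ε S ^ q`, the limit `S ^ q` is at
most `∑ ‖ℰ φ_j‖_q ^ q ≤ S ^ q ∑ ‖φ_j‖ ^ q`. Hence `∑ ‖φ_j‖ ^ q ≥ 1 - ε` (`exists_profiles`).

*The competing bound.* With `τ = max(p, p')` one has `∑ ‖φ_j‖ ^ τ ≤ 1` (`sum_norm_rpow_le_one`).
By duality this follows from the decoupling inequality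
`limsup ‖∑ e^{i x_j·ω} ψ_j‖_r ≤ (∑ ‖ψ_j‖_r ^ t) ^ (1 / t)`, `t = min(r, r')`, for diverging `x_j`
and `r = p'` (`eventually_norm_sum_modulate_le`). For simple functions it follows on each cell of
constancy from a Hausdorff-Young inequality for the characters `e^{i x_j·ω}`, which are almost
orthogonal by the Riemann-Lebesgue lemma; that the constant is sharp matters, and F. Riesz's proof
of Hausdorff-Young, which needs no interpolation theory, provides it.

*Compactness.* Since `τ < q`, the two bounds force `‖φ_j‖` arbitrarily close to `1` for some `j`,
and two profiles of norm close to `1` agree up to a modulation. So there is a weak limit of norm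
`1`, and by uniform convexity of `L^p` the convergence is strong (`exists_tendsto_modulate`). For
`q = ∞` one takes the weak limit after moving a maximum of `|F_n|` to the origin. The shifts so far
depend on `U`; as `ℰ φ` vanishes at infinity, they stay within bounded distance of a maximum of
`|F_n|`, and therefore maxima `x_n` of `|F_n|` work for all ultrafilters at once.
-/

noncomputable section

namespace SphereExtension

/-! ### First variation at maximizers of the Hausdorff-Young functional -/

section FirstVariation

variable {Ω ι : Type*} [Fintype ι] {u : ι → Ω → ℂ}

theorem norm_sum_mul_le (hu1 : ∀ j ω, ‖u j ω‖ = 1) (c : ι → ℂ) (ω : Ω) :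
    ‖∑ j, c j * u j ω‖ ≤ ∑ j, ‖c j‖ := by
  refine (norm_sum_le _ _).trans (Finset.sum_le_sum fun j _ => ?_)
  rw [norm_mul, hu1, mul_one]

variable [MeasurableSpace Ω] {ν : Measure Ω}

theorem aestronglyMeasurable_sum_mul (hu : ∀ j, AEStronglyMeasurable (u j) ν) (c : ι → ℂ) :
    AEStronglyMeasurable (fun ω => ∑ j, c j * u j ω) ν := by
  have := Finset.aestronglyMeasurable_sum (μ := ν) Finset.univ
    (f := fun j ω => c j * u j ω) fun j _ => (hu j).const_mul (c j)
  convert this using 1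
  ext ω
  simp

variable [IsFiniteMeasure ν]

theorem integrable_norm_sum_mul_rpow (hu : ∀ j, AEStronglyMeasurable (u j) ν)
    (hu1 : ∀ j ω, ‖u j ω‖ = 1) (c : ι → ℂ) {s : ℝ} (hs : 0 ≤ s) :
    Integrable (fun ω => ‖∑ j, c j * u j ω‖ ^ s) ν := by
  refine Integrable.of_bound
    ((aestronglyMeasurable_sum_mul hu c).norm.aemeasurable.pow_const s).aestronglyMeasurable
    ((∑ j, ‖c j‖) ^ s) (Eventually.of_forall fun ω => ?_)
  rw [Real.norm_of_nonneg (by positivity)]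
  exact Real.rpow_le_rpow (norm_nonneg _) (norm_sum_mul_le hu1 c ω) hs

theorem continuous_integral_norm_sum_mul_rpow (hu : ∀ j, AEStronglyMeasurable (u j) ν)
    (hu1 : ∀ j ω, ‖u j ω‖ = 1) {s : ℝ} (hs : 0 ≤ s) :
    Continuous fun c : ι → ℂ => ∫ ω, ‖∑ j, c j * u j ω‖ ^ s ∂ν := by
  rw [continuous_iff_continuousAt]
  intro c₀
  refine continuousAt_of_dominated (bound := fun _ => (∑ j, (‖c₀ j‖ + 1)) ^ s)
    (Eventually.of_forall fun c => (integrable_norm_sum_mul_rpow hu hu1 c hs).1) ?_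
    (integrable_const _) (Eventually.of_forall fun ω => ?_)
  · filter_upwards [Metric.ball_mem_nhds c₀ one_pos] with c hc
    refine Eventually.of_forall fun ω => ?_
    rw [Real.norm_of_nonneg (by positivity)]
    refine Real.rpow_le_rpow (norm_nonneg _) ((norm_sum_mul_le hu1 c ω).trans
      (Finset.sum_le_sum fun j _ => ?_)) hs
    have h1 : ‖c j - c₀ j‖ ≤ 1 := by
      rw [← dist_eq_norm]
      exact (dist_le_pi_dist c c₀ j).trans hc.le
    linarith [norm_le_norm_add_norm_sub' (c j) (c₀ j)]
  · have : Continuous fun c : ι → ℂ => ‖∑ j, c j * u j ω‖ := by fun_prop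
    exact (this.rpow_const fun _ => Or.inr hs).continuousAt

/-- The dual exponents of `s` and `2 s - 2` are `s / (s - 1)` and `(2 s - 2) / (2 s - 3)`; the
second lies between `2 / (s - 1)` and the first, and the weights in Hölder's inequality are such
that no constant is lost. -/
theorem sum_rpow_dual_le {a : ι → ℝ} (ha : ∀ j, 0 ≤ a j) {s : ℝ} (hs : 2 < s)
    (h1 : ∑ j, a j ^ (s / (s - 1)) = 1) :
    (∑ j, a j ^ ((2 * s - 2) / (2 * s - 3))) ^ (2 * s - 3) ≤ ∑ j, a j ^ (2 / (s - 1)) := by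
  have e0 : 0 < s - 1 := by linarith
  have e1 : 0 < 2 * s - 3 := by linarith
  have e2 : 0 < 2 * s - 4 := by linarith
  have hpq : (2 * s - 3).HolderConjugate ((2 * s - 3) / (2 * s - 4)) := by
    rw [Real.holderConjugate_iff]
    refine ⟨by linarith, ?_⟩
    field_simp
    ring
  have key := Real.inner_le_Lp_mul_Lq_of_nonneg (s := Finset.univ) hpq
    (f := fun j => a j ^ (2 / (s - 1) * (2 * s - 3)⁻¹))
    (g := fun j => a j ^ (s / (s - 1) * ((2 * s - 3) / (2 * s - 4))⁻¹))
    (fun j _ => Real.rpow_nonneg (ha j) _) (fun j _ => Real.rpow_nonneg (ha j) _)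
  have hL : ∀ j, a j ^ (2 / (s - 1) * (2 * s - 3)⁻¹) *
      a j ^ (s / (s - 1) * ((2 * s - 3) / (2 * s - 4))⁻¹) = a j ^ ((2 * s - 2) / (2 * s - 3)) := by
    intro j
    have he : 2 / (s - 1) * (2 * s - 3)⁻¹ + s / (s - 1) * ((2 * s - 3) / (2 * s - 4))⁻¹ =
        (2 * s - 2) / (2 * s - 3) := by
      field_simp
      ring
    rw [← he, Real.rpow_add_of_nonneg (ha j) (by positivity) (by positivity)]
  have hR1 : ∀ j, (a j ^ (2 / (s - 1) * (2 * s - 3)⁻¹)) ^ (2 * s - 3) = a j ^ (2 / (s - 1)) := by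
    intro j
    rw [← Real.rpow_mul (ha j)]
    congr 1
    field_simp
  have hR2 : ∀ j, (a j ^ (s / (s - 1) * ((2 * s - 3) / (2 * s - 4))⁻¹)) ^
      ((2 * s - 3) / (2 * s - 4)) = a j ^ (s / (s - 1)) := by
    intro j
    rw [← Real.rpow_mul (ha j), mul_assoc, inv_mul_cancel₀ (by positivity), mul_one]
  simp only [hL, hR1, hR2, h1, Real.one_rpow, mul_one] at key
  have h0 : 0 ≤ ∑ j, a j ^ (2 / (s - 1)) :=
    Finset.sum_nonneg fun j _ => Real.rpow_nonneg (ha j) _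
  calc _ ≤ ((∑ j, a j ^ (2 / (s - 1))) ^ (1 / (2 * s - 3))) ^ (2 * s - 3) :=
        Real.rpow_le_rpow (Finset.sum_nonneg fun j _ => Real.rpow_nonneg (ha j) _) key e1.le
    _ = _ := by
        rw [← Real.rpow_mul h0, one_div, inv_mul_cancel₀ e1.ne', Real.rpow_one]

/-- First variation at a maximizer `d` in the direction `-x`, `x j = |d j| ^ (s' - 2) d j` with
`s' = s / (s - 1)`. -/
theorem maximizer_first_variation (hu : ∀ j, AEStronglyMeasurable (u j) ν)
    (hu1 : ∀ j ω, ‖u j ω‖ = 1) {s K : ℝ} (hs : 2 < s) {d : ι → ℂ}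
    (hd1 : ∑ j, ‖d j‖ ^ (s / (s - 1)) = 1) (hd : ∫ ω, ‖∑ j, d j * u j ω‖ ^ s ∂ν = K)
    (hK : ∀ c : ι → ℂ, ∫ ω, ‖∑ j, c j * u j ω‖ ^ s ∂ν ≤
      K * (∑ j, ‖c j‖ ^ (s / (s - 1))) ^ (s - 1)) :
    K * ∑ j, ‖d j‖ ^ (2 / (s - 1)) ≤
      ∫ ω, ‖∑ j, d j * u j ω‖ ^ (s - 1) *
        ‖∑ j, (‖d j‖ ^ (s / (s - 1) - 2) : ℝ) * d j * u j ω‖ ∂ν := by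
  have e0 : 0 < s - 1 := by linarith
  set s' := s / (s - 1) with hs'
  have hs'0 : 0 < s' := by positivity
  set F : Ω → ℂ := fun ω => ∑ j, d j * u j ω with hF
  set W : Ω → ℂ := fun ω => ∑ j, (‖d j‖ ^ (s' - 2) : ℝ) * d j * u j ω with hW
  have hFm := aestronglyMeasurable_sum_mul hu d
  have hWm := aestronglyMeasurable_sum_mul hu (fun j => ((‖d j‖ ^ (s' - 2) : ℝ) : ℂ) * d j)
  have hFWi : Integrable (fun ω => ‖F ω‖ ^ (s - 1) * ‖W ω‖) ν := by
    refine Integrable.of_bound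
      ((hFm.norm.aemeasurable.pow_const (s - 1)).mul hWm.norm.aemeasurable).aestronglyMeasurable
      ((∑ j, ‖d j‖) ^ (s - 1) * ∑ j, ‖((‖d j‖ ^ (s' - 2) : ℝ) : ℂ) * d j‖)
      (Eventually.of_forall fun ω => ?_)
    rw [Real.norm_of_nonneg (by positivity)]
    have h1 := norm_sum_mul_le hu1 d ω
    have h2 := norm_sum_mul_le hu1 (fun j => ((‖d j‖ ^ (s' - 2) : ℝ) : ℂ) * d j) ω
    gcongr
  set I := ∫ ω, ‖F ω‖ ^ (s - 1) * ‖W ω‖ ∂ν with hI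
  -- the function of `ε` that is nonnegative for small `ε ≥ 0` and vanishes at `0`
  let h : ℝ → ℝ := fun ε =>
    K * (∑ j, ‖d j‖ ^ s' * (1 - ε * ‖d j‖ ^ (s' - 2)) ^ s') ^ (s - 1) - K + ε * (s * I)
  have hsmall : ∀ᶠ ε in 𝓝[>] (0 : ℝ), ∀ j, 0 ≤ 1 - ε * ‖d j‖ ^ (s' - 2) := by
    refine eventually_all.2 fun j => ?_
    have : Tendsto (fun ε : ℝ => 1 - ε * ‖d j‖ ^ (s' - 2)) (𝓝[>] 0) (𝓝 (1 - 0 * _)) :=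
      ((continuous_const.sub (continuous_id.mul continuous_const)).tendsto 0).mono_left
        nhdsWithin_le_nhds
    rw [zero_mul, sub_zero] at this
    filter_upwards [this.eventually (lt_mem_nhds one_pos)] with ε hε using hε.le
  have hnonneg : ∀ᶠ ε in 𝓝[>] (0 : ℝ), 0 ≤ h ε := by
    filter_upwards [hsmall, self_mem_nhdsWithin] with ε hε hε0
    replace hε0 : 0 < ε := hε0
    set c : ι → ℂ := fun j => d j - ε * (((‖d j‖ ^ (s' - 2) : ℝ) : ℂ) * d j) with hc
    have hcn : ∀ j, ‖c j‖ ^ s' = ‖d j‖ ^ s' * (1 - ε * ‖d j‖ ^ (s' - 2)) ^ s' := by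
      intro j
      have : c j = ((1 - ε * ‖d j‖ ^ (s' - 2) : ℝ) : ℂ) * d j := by
        simp only [hc]; push_cast; ring
      rw [this, norm_mul, Complex.norm_real, Real.norm_of_nonneg (hε j),
        Real.mul_rpow (hε j) (norm_nonneg _), mul_comm]
    have hcF : ∀ ω, ∑ j, c j * u j ω = F ω - ε * W ω := by
      intro ω
      simp only [hF, hW, hc, Finset.mul_sum, ← Finset.sum_sub_distrib]
      refine Finset.sum_congr rfl fun j _ => ?_
      ring
    -- Bernoulli's inequality, trivial when `‖F ω‖ ≤ ε ‖W ω‖`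
    have hpt : ∀ ω, ‖F ω‖ ^ s - ε * s * (‖F ω‖ ^ (s - 1) * ‖W ω‖) ≤ ‖∑ j, c j * u j ω‖ ^ s := by
      intro ω
      rw [hcF]
      have hn : ‖F ω‖ - ε * ‖W ω‖ ≤ ‖F ω - ε * W ω‖ := by
        have := norm_sub_norm_le (F ω) (ε * W ω)
        rwa [norm_mul, Complex.norm_real, Real.norm_of_nonneg hε0.le] at this
      rcases (norm_nonneg (F ω)).eq_or_lt with h0 | h0
      · rw [← h0, Real.zero_rpow (by linarith), Real.zero_rpow e0.ne']
        simp only [zero_mul, mul_zero, sub_zero]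
        positivity
      rcases le_or_gt (‖F ω‖) (ε * ‖W ω‖) with h1 | h1
      · have : ‖F ω‖ ^ s = ‖F ω‖ ^ (s - 1) * ‖F ω‖ := by
          rw [← Real.rpow_add_one h0.ne']; congr 1; ring
        have h3 : 0 ≤ ‖F ω‖ ^ (s - 1) := by positivity
        have h4 : 0 ≤ ‖F ω - ε * W ω‖ ^ s := by positivity
        have h5 : ‖F ω‖ ^ (s - 1) * ‖F ω‖ ≤ ‖F ω‖ ^ (s - 1) * (ε * ‖W ω‖) := by gcongr
        have h6 : ‖F ω‖ ^ (s - 1) * (ε * ‖W ω‖) * 1 ≤ ‖F ω‖ ^ (s - 1) * (ε * ‖W ω‖) * s := by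
          gcongr; linarith
        rw [this]; nlinarith
      · have hb := one_add_mul_self_le_rpow_one_add (s := -(ε * ‖W ω‖ / ‖F ω‖)) (p := s)
          (by rw [neg_le_neg_iff, div_le_one h0]; exact h1.le) (by linarith)
        have h3 : (‖F ω‖ - ε * ‖W ω‖) ^ s =
            ‖F ω‖ ^ s * (1 + -(ε * ‖W ω‖ / ‖F ω‖)) ^ s := by
          rw [← Real.mul_rpow h0.le]
          · congr 1; field_simp; ring
          · have : ε * ‖W ω‖ / ‖F ω‖ ≤ 1 := by rw [div_le_one h0]; exact h1.le
            linarith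
        have h4 : ‖F ω‖ ^ s = ‖F ω‖ ^ (s - 1) * ‖F ω‖ := by
          rw [← Real.rpow_add_one h0.ne']; congr 1; ring
        calc ‖F ω‖ ^ s - ε * s * (‖F ω‖ ^ (s - 1) * ‖W ω‖)
            = ‖F ω‖ ^ s * (1 + s * -(ε * ‖W ω‖ / ‖F ω‖)) := by
              rw [h4]; field_simp; ring
          _ ≤ ‖F ω‖ ^ s * (1 + -(ε * ‖W ω‖ / ‖F ω‖)) ^ s := by gcongr
          _ = (‖F ω‖ - ε * ‖W ω‖) ^ s := h3.symm
          _ ≤ _ := Real.rpow_le_rpow (by linarith) hn (by linarith)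
    have hi1 := integrable_norm_sum_mul_rpow hu hu1 d (s := s) (by linarith)
    have hi2 := integrable_norm_sum_mul_rpow hu hu1 c (s := s) (by linarith)
    have hint : K - ε * s * I ≤ ∫ ω, ‖∑ j, c j * u j ω‖ ^ s ∂ν := by
      rw [← hd, hI, ← integral_const_mul, ← integral_sub hi1 (hFWi.const_mul _)]
      exact integral_mono (hi1.sub (hFWi.const_mul _)) hi2 hpt
    have h1 := hint.trans (hK c)
    rw [Finset.sum_congr rfl fun j _ => hcn j] at h1
    simp only [h]
    linarith
  have hderiv : HasDerivAt h (K * ((∑ j, ‖d j‖ ^ s' * (-(‖d j‖ ^ (s' - 2)) * s')) * (s - 1))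
      + s * I) 0 := by
    have h1 : ∀ j, HasDerivAt (fun ε : ℝ => ‖d j‖ ^ s' * (1 - ε * ‖d j‖ ^ (s' - 2)) ^ s')
        (‖d j‖ ^ s' * (-(‖d j‖ ^ (s' - 2)) * s')) 0 := by
      intro j
      have := (((hasDerivAt_id (0 : ℝ)).mul_const (‖d j‖ ^ (s' - 2))).const_sub 1).rpow_const
        (p := s') (Or.inl (by simp))
      simpa using this.const_mul (‖d j‖ ^ s')
    have h2 := HasDerivAt.fun_sum (u := Finset.univ) fun j _ => h1 j
    have h3 := h2.rpow_const (p := s - 1) (Or.inl (by simp [hd1]))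
    have h4 := ((h3.const_mul K).sub_const K).add
      ((hasDerivAt_id (0 : ℝ)).mul_const (s * I))
    have h5 : HasDerivAt h _ 0 := h4
    exact h5.congr_deriv (by simp [hd1])
  have h0 : h 0 = 0 := by simp [h, hd1]
  have hge : 0 ≤ K * ((∑ j, ‖d j‖ ^ s' * (-(‖d j‖ ^ (s' - 2)) * s')) * (s - 1)) + s * I := by
    have hsl := hderiv.tendsto_slope.mono_left
      (nhdsWithin_mono (0 : ℝ) (fun x (hx : x ∈ Set.Ioi 0) => (ne_of_gt hx : x ≠ 0)))
    refine ge_of_tendsto hsl ?_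
    filter_upwards [hnonneg, self_mem_nhdsWithin] with ε h1 h2
    rw [slope_def_field, h0]
    have : (0 : ℝ) < ε := h2
    simp only [sub_zero]
    positivity
  have hQ : ∑ j, ‖d j‖ ^ s' * (-(‖d j‖ ^ (s' - 2)) * s') = -s' * ∑ j, ‖d j‖ ^ (2 / (s - 1)) := by
    rw [Finset.mul_sum]
    refine Finset.sum_congr rfl fun j _ => ?_
    have hexp : s' + (s' - 2) = 2 / (s - 1) := by rw [hs']; field_simp; ring
    rcases (norm_nonneg (d j)).eq_or_lt with h0 | h0
    · rw [← h0, Real.zero_rpow hs'0.ne', Real.zero_rpow (div_pos two_pos e0).ne']; ring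
    · rw [← hexp, Real.rpow_add h0]; ring
  rw [hQ] at hge
  have : s' * (s - 1) = s := by rw [hs']; field_simp
  have h5 : s * (K * ∑ j, ‖d j‖ ^ (2 / (s - 1))) ≤ s * I := by
    have : K * (-s' * (∑ j, ‖d j‖ ^ (2 / (s - 1))) * (s - 1)) =
      -((s' * (s - 1)) * (K * ∑ j, ‖d j‖ ^ (2 / (s - 1)))) := by ring
    rw [this, ‹s' * (s - 1) = s›] at hge
    linarith
  exact le_of_mul_le_mul_left h5 (by linarith)

end FirstVariation

/-! ### The Hausdorff-Young inequality for almost orthogonal systems -/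

section HausdorffYoung

variable {Ω ι : Type*} [Fintype ι] {u : ι → Ω → ℂ} [MeasurableSpace Ω] {ν : Measure Ω}
  [IsFiniteMeasure ν] {B : ℝ}

/-- The supremum of `∫ |∑ c_j u_j| ^ s` over the unit sphere of `ℓ^{s'}` is attained; the
conclusion is its homogeneous form. -/
theorem exists_maximizer [Nonempty ι] (hu : ∀ j, AEStronglyMeasurable (u j) ν)
    (hu1 : ∀ j ω, ‖u j ω‖ = 1) {s : ℝ} (hs : 1 < s) :
    ∃ d : ι → ℂ, ∑ j, ‖d j‖ ^ (s / (s - 1)) = 1 ∧ ∀ c : ι → ℂ,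
      ∫ ω, ‖∑ j, c j * u j ω‖ ^ s ∂ν ≤
        (∫ ω, ‖∑ j, d j * u j ω‖ ^ s ∂ν) * (∑ j, ‖c j‖ ^ (s / (s - 1))) ^ (s - 1) := by
  have e0 : 0 < s - 1 := by linarith
  have hs0 : 0 < s := by linarith
  set s' := s / (s - 1) with hs'
  have hs'0 : 0 < s' := by positivity
  have hcont : Continuous fun c : ι → ℂ => ∑ j, ‖c j‖ ^ s' := by
    refine continuous_finsetSum _ fun j _ => ?_
    exact ((continuous_apply j).norm).rpow_const fun _ => Or.inr hs'0.le
  have hT : IsCompact {c : ι → ℂ | ∑ j, ‖c j‖ ^ s' = 1} := by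
    refine Metric.isCompact_of_isClosed_isBounded (isClosed_eq hcont continuous_const) ?_
    refine Metric.isBounded_closedBall (x := (0 : ι → ℂ)) (r := 1) |>.subset fun c hc => ?_
    rw [mem_closedBall_zero_iff, pi_norm_le_iff_of_nonneg zero_le_one]
    intro j
    have h1 : ‖c j‖ ^ s' ≤ 1 := by
      rw [← (hc : ∑ j, ‖c j‖ ^ s' = 1)]
      exact Finset.single_le_sum (f := fun j => ‖c j‖ ^ s') (fun i _ => by positivity)
        (Finset.mem_univ j)
    by_contra! h2
    exact absurd h1 (not_le.2 (Real.one_lt_rpow h2 hs'0))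
  have hne : {c : ι → ℂ | ∑ j, ‖c j‖ ^ s' = 1}.Nonempty := by
    classical
    obtain ⟨i⟩ := ‹Nonempty ι›
    refine ⟨Pi.single i 1, ?_⟩
    rw [Set.mem_ofPred_eq, Finset.sum_eq_single i]
    · simp
    · intro j _ hj
      simp [Pi.single_eq_of_ne hj, Real.zero_rpow hs'0.ne']
    · simp
  obtain ⟨d, hd, hmax⟩ := hT.exists_isMaxOn hne
    (continuous_integral_norm_sum_mul_rpow hu hu1 hs0.le).continuousOn
  refine ⟨d, hd, fun c => ?_⟩
  set N := ∑ j, ‖c j‖ ^ s' with hN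
  have hN0 : 0 ≤ N := Finset.sum_nonneg fun j _ => by positivity
  rcases hN0.eq_or_lt with h0 | h0
  · have hc : ∀ j, c j = 0 := by
      intro j
      have := (Finset.sum_eq_zero_iff_of_nonneg (fun j _ => by positivity)).1 h0.symm j
        (Finset.mem_univ j)
      simpa [Real.rpow_eq_zero (norm_nonneg _) hs'0.ne'] using this
    simp [hc, ← h0, Real.zero_rpow hs0.ne', Real.zero_rpow e0.ne']
  · set r : ℝ := N ^ (-s'⁻¹) with hr
    have hr0 : 0 < r := Real.rpow_pos_of_pos h0 _
    have hmem : (fun j => (r : ℂ) * c j) ∈ {c : ι → ℂ | ∑ j, ‖c j‖ ^ s' = 1} := by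
      have : ∀ j, ‖(r : ℂ) * c j‖ ^ s' = N⁻¹ * ‖c j‖ ^ s' := by
        intro j
        rw [norm_mul, Complex.norm_real, Real.norm_of_nonneg hr0.le,
          Real.mul_rpow hr0.le (norm_nonneg _), hr, ← Real.rpow_mul h0.le, neg_mul,
          inv_mul_cancel₀ hs'0.ne', Real.rpow_neg_one]
      rw [Set.mem_ofPred_eq, Finset.sum_congr rfl fun j _ => this j, ← Finset.mul_sum, ← hN,
        inv_mul_cancel₀ h0.ne']
    have h1 := hmax hmem
    simp only [Set.mem_ofPred_eq] at h1
    have h2 : ∀ ω, ‖∑ j, (r : ℂ) * c j * u j ω‖ ^ s = r ^ s * ‖∑ j, c j * u j ω‖ ^ s := by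
      intro ω
      have : ∑ j, (r : ℂ) * c j * u j ω = r * ∑ j, c j * u j ω := by
        rw [Finset.mul_sum]
        exact Finset.sum_congr rfl fun j _ => by ring
      rw [this, norm_mul, Complex.norm_real, Real.norm_of_nonneg hr0.le,
        Real.mul_rpow hr0.le (norm_nonneg _)]
    simp only [h2, integral_const_mul] at h1
    have h3 : r ^ s * N ^ (s - 1) = 1 := by
      rw [hr, ← Real.rpow_mul h0.le, ← Real.rpow_add h0]
      have : -s'⁻¹ * s + (s - 1) = 0 := by rw [hs']; field_simp; ring
      rw [this, Real.rpow_zero]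
    have h4 : 0 < N ^ (s - 1) := by positivity
    calc _ = (r ^ s * ∫ ω, ‖∑ j, c j * u j ω‖ ^ s ∂ν) * N ^ (s - 1) := by
          rw [mul_right_comm, h3, one_mul]
      _ ≤ _ := by gcongr

/-- One step of F. Riesz's proof of the Hausdorff-Young inequality: the bound for the exponent
`2 s - 2` gives a better one for `s`. -/
theorem integral_norm_sum_mul_rpow_le_step (hu : ∀ j, AEStronglyMeasurable (u j) ν)
    (hu1 : ∀ j ω, ‖u j ω‖ = 1) (hB0 : 0 < B)
    (hB : ∀ c : ι → ℂ, ∫ ω, ‖∑ j, c j * u j ω‖ ^ (2 : ℝ) ∂ν ≤ B * ∑ j, ‖c j‖ ^ (2 : ℝ))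
    {s C : ℝ} (hs : 2 < s) (hC0 : 0 < C)
    (hC : ∀ c : ι → ℂ, ∫ ω, ‖∑ j, c j * u j ω‖ ^ (2 * s - 2) ∂ν ≤
      C * (∑ j, ‖c j‖ ^ ((2 * s - 2) / (2 * s - 3))) ^ (2 * s - 3)) (c : ι → ℂ) :
    ∫ ω, ‖∑ j, c j * u j ω‖ ^ s ∂ν ≤
      √(B * C) * (∑ j, ‖c j‖ ^ (s / (s - 1))) ^ (s - 1) := by
  have e0 : 0 < s - 1 := by linarith
  rcases isEmpty_or_nonempty ι with hι | hι
  · simp [Real.zero_rpow (by linarith : s ≠ 0), Real.zero_rpow e0.ne']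
  obtain ⟨d, hd1, hmax⟩ := exists_maximizer hu hu1 (by linarith : 1 < s)
  refine (hmax c).trans ?_
  gcongr
  set K := ∫ ω, ‖∑ j, d j * u j ω‖ ^ s ∂ν with hK
  set Q := ∑ j, ‖d j‖ ^ (2 / (s - 1)) with hQ
  have hvar := maximizer_first_variation hu hu1 hs hd1 hK.symm hmax
  rw [← hQ] at hvar
  set x : ι → ℂ := fun j => ((‖d j‖ ^ (s / (s - 1) - 2) : ℝ) : ℂ) * d j with hx
  have hxQ : ∑ j, ‖x j‖ ^ (2 : ℝ) = Q := by
    refine Finset.sum_congr rfl fun j _ => ?_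
    rw [hx, norm_mul, Complex.norm_real, Real.norm_of_nonneg (by positivity)]
    rcases (norm_nonneg (d j)).eq_or_lt with h0 | h0
    · rw [← h0, mul_zero, Real.zero_rpow two_ne_zero, Real.zero_rpow (div_pos two_pos e0).ne']
    · rw [← Real.rpow_add_one h0.ne', ← Real.rpow_mul h0.le]
      congr 1
      field_simp
      ring
  have hQ0 : 0 < Q := by
    have h0 : 0 ≤ Q := Finset.sum_nonneg fun j _ => by positivity
    refine h0.lt_of_ne fun h => ?_
    have hz : ∀ j, ‖d j‖ = 0 := fun j => by
      have := (Finset.sum_eq_zero_iff_of_nonneg (fun j _ => by positivity)).1 h.symm j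
        (Finset.mem_univ j)
      rwa [Real.rpow_eq_zero (norm_nonneg _) (div_pos two_pos e0).ne'] at this
    simp [hz, Real.zero_rpow (div_pos (by linarith : 0 < s) e0).ne'] at hd1
  have hF2 : ∫ ω, ‖∑ j, d j * u j ω‖ ^ (2 * s - 2) ∂ν ≤ C * Q :=
    (hC d).trans (by gcongr; exact sum_rpow_dual_le (fun j => norm_nonneg (d j)) hs hd1)
  have hW2 : ∫ ω, ‖∑ j, x j * u j ω‖ ^ (2 : ℝ) ∂ν ≤ B * Q := (hB x).trans_eq (by rw [hxQ])
  -- Cauchy-Schwarz in the form `a b ≤ a ^ 2 / (2 l) + l b ^ 2 / 2`, with `l` optimal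
  set l := √(C / B) with hl
  have hl0 : 0 < l := Real.sqrt_pos.2 (by positivity)
  have hpt : ∀ ω, ‖∑ j, d j * u j ω‖ ^ (s - 1) * ‖∑ j, x j * u j ω‖ ≤
      (2 * l)⁻¹ * ‖∑ j, d j * u j ω‖ ^ (2 * s - 2) + l / 2 * ‖∑ j, x j * u j ω‖ ^ (2 : ℝ) := by
    intro ω
    set a := ‖∑ j, d j * u j ω‖
    set b := ‖∑ j, x j * u j ω‖
    have ha : a ^ (2 * s - 2) = (a ^ (s - 1)) ^ 2 := by
      rw [← Real.rpow_mul_natCast (norm_nonneg _)]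
      congr 1
      push_cast
      ring
    rw [ha, Real.rpow_two]
    have h1 : (2 * l)⁻¹ * (a ^ (s - 1)) ^ 2 + l / 2 * b ^ 2 - a ^ (s - 1) * b =
      (2 * l)⁻¹ * (a ^ (s - 1) - l * b) ^ 2 := by field_simp; ring
    have h2 : 0 ≤ (2 * l)⁻¹ * (a ^ (s - 1) - l * b) ^ 2 := by positivity
    linarith
  have hi1 := (integrable_norm_sum_mul_rpow hu hu1 d
    (by linarith : 0 ≤ 2 * s - 2)).const_mul (2 * l)⁻¹
  have hi2 := (integrable_norm_sum_mul_rpow hu hu1 x zero_le_two).const_mul (l / 2)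
  have hint : K * Q ≤ (2 * l)⁻¹ * (C * Q) + l / 2 * (B * Q) := by
    refine hvar.trans ((integral_mono_of_nonneg (Eventually.of_forall fun ω => by positivity)
      (hi1.add hi2) (Eventually.of_forall hpt)).trans ?_)
    simp only [Pi.add_apply]
    rw [integral_add hi1 hi2, integral_const_mul, integral_const_mul]
    gcongr
  have hval : (2 * l)⁻¹ * (C * Q) + l / 2 * (B * Q) = √(B * C) * Q := by
    have h1 : l * B = √(B * C) := by
      rw [hl, eq_comm, Real.sqrt_eq_iff_mul_self_eq (by positivity) (by positivity)]
      have := Real.mul_self_sqrt (by positivity : 0 ≤ C / B)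
      calc B * C = √(C / B) * √(C / B) * (B * B) := by rw [this]; field_simp
        _ = _ := by ring
    have h2 : l⁻¹ * C = l * B := by
      have := Real.mul_self_sqrt (by positivity : 0 ≤ C / B)
      rw [← hl] at this
      field_simp
      field_simp at this
      linarith
    rw [mul_inv, ← h1]
    calc _ = 2⁻¹ * (l⁻¹ * C) * Q + l / 2 * (B * Q) := by ring
      _ = _ := by rw [h2]; ring
  rw [hval] at hint
  exact le_of_mul_le_mul_right hint hQ0

/-- The Hausdorff-Young inequality for an almost orthogonal system of unimodular functions, with
`B` a Bessel constant that is at least the total mass. The trivial bound loses a factor `J`, the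
number of functions, at every exponent, and each application of Riesz's step replaces that factor
by its square root. -/
theorem integral_norm_sum_mul_rpow_le_of_two_lt (hu : ∀ j, AEStronglyMeasurable (u j) ν)
    (hu1 : ∀ j ω, ‖u j ω‖ = 1) (hB0 : 0 < B) (hνB : ν.real Set.univ ≤ B)
    (hB : ∀ c : ι → ℂ, ∫ ω, ‖∑ j, c j * u j ω‖ ^ (2 : ℝ) ∂ν ≤ B * ∑ j, ‖c j‖ ^ (2 : ℝ))
    {s : ℝ} (hs : 2 < s) (c : ι → ℂ) :
    ∫ ω, ‖∑ j, c j * u j ω‖ ^ s ∂ν ≤ B * (∑ j, ‖c j‖ ^ (s / (s - 1))) ^ (s - 1) := by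
  rcases isEmpty_or_nonempty ι with hι | hι
  · simp [Real.zero_rpow (by linarith : s ≠ 0), Real.zero_rpow (by linarith : s - 1 ≠ 0)]
  set J : ℝ := (Fintype.card ι : ℝ) with hJ
  have hJ1 : 0 < J := by rw [hJ]; exact_mod_cast Fintype.card_pos
  have key : ∀ k : ℕ, ∀ s : ℝ, 2 < s → ∀ c : ι → ℂ, ∫ ω, ‖∑ j, c j * u j ω‖ ^ s ∂ν ≤
      B * J ^ ((1 / 2 : ℝ) ^ k) * (∑ j, ‖c j‖ ^ (s / (s - 1))) ^ (s - 1) := by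
    intro k
    induction k with
    | zero =>
      intro s hs c
      have e0 : 0 < s - 1 := by linarith
      have h1 : (∑ j, ‖c j‖) ^ s ≤ J * (∑ j, ‖c j‖ ^ (s / (s - 1))) ^ (s - 1) := by
        have hpq : (s / (s - 1)).HolderConjugate s := by
          rw [Real.holderConjugate_iff]
          refine ⟨by rw [lt_div_iff₀ e0]; linarith, ?_⟩
          field_simp
          ring
        have h := Real.inner_le_Lp_mul_Lq_of_nonneg (s := Finset.univ) hpq
          (f := fun j => ‖c j‖) (g := fun _ => (1 : ℝ)) (fun j _ => norm_nonneg _)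
          (fun _ _ => zero_le_one)
        simp only [mul_one, Real.one_rpow, Finset.sum_const, Finset.card_univ, nsmul_eq_mul,
          ← hJ] at h
        have hN : 0 ≤ ∑ j, ‖c j‖ ^ (s / (s - 1)) := Finset.sum_nonneg fun j _ => by positivity
        calc _ ≤ ((∑ j, ‖c j‖ ^ (s / (s - 1))) ^ (1 / (s / (s - 1))) * J ^ (1 / s)) ^ s :=
              Real.rpow_le_rpow (Finset.sum_nonneg fun j _ => norm_nonneg _) h (by linarith)
          _ = _ := by
              rw [Real.mul_rpow (by positivity) (by positivity), ← Real.rpow_mul hN,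
                ← Real.rpow_mul hJ1.le, one_div_mul_cancel (by linarith), Real.rpow_one, mul_comm]
              congr 2
              field_simp
      calc _ ≤ ∫ ω, (∑ j, ‖c j‖) ^ s ∂ν := by
            refine integral_mono (integrable_norm_sum_mul_rpow hu hu1 c (by linarith))
              (integrable_const _) fun ω => ?_
            exact Real.rpow_le_rpow (norm_nonneg _) (norm_sum_mul_le hu1 c ω) (by linarith)
        _ = ν.real Set.univ * (∑ j, ‖c j‖) ^ s := by rw [integral_const, smul_eq_mul]
        _ ≤ B * (J * (∑ j, ‖c j‖ ^ (s / (s - 1))) ^ (s - 1)) := by gcongr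
        _ = _ := by rw [pow_zero, Real.rpow_one, mul_assoc]
    | succ k ih =>
      intro s hs c
      have h1 := integral_norm_sum_mul_rpow_le_step hu hu1 hB0 hB hs
        (C := B * J ^ ((1 / 2 : ℝ) ^ k)) (by positivity) (fun c => by
          have := ih (2 * s - 2) (by linarith) c
          rwa [show 2 * s - 2 - 1 = 2 * s - 3 by ring] at this) c
      refine h1.trans_eq ?_
      congr 1
      rw [Real.sqrt_eq_iff_mul_self_eq (by positivity) (by positivity)]
      have : J ^ ((1 / 2 : ℝ) ^ (k + 1)) * J ^ ((1 / 2 : ℝ) ^ (k + 1)) = J ^ ((1 / 2 : ℝ) ^ k) := by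
        rw [← Real.rpow_add hJ1]
        congr 1
        ring
      rw [← this]
      ring
  have hlim : Tendsto (fun k : ℕ => B * J ^ ((1 / 2 : ℝ) ^ k) *
      (∑ j, ‖c j‖ ^ (s / (s - 1))) ^ (s - 1)) atTop
      (𝓝 (B * J ^ (0 : ℝ) * (∑ j, ‖c j‖ ^ (s / (s - 1))) ^ (s - 1))) := by
    refine Tendsto.mul_const _ (Tendsto.const_mul _ ?_)
    exact (Real.continuous_const_rpow hJ1.ne').continuousAt.tendsto.comp
      (tendsto_pow_atTop_nhds_zero_of_lt_one (by norm_num) (by norm_num))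
  rw [Real.rpow_zero, mul_one] at hlim
  exact ge_of_tendsto' hlim fun k => key k s hs c

/-- The Hausdorff-Young inequality and, for exponents below `2`, Jensen's inequality. -/
theorem integral_norm_sum_mul_rpow_le (hu : ∀ j, AEStronglyMeasurable (u j) ν)
    (hu1 : ∀ j ω, ‖u j ω‖ = 1) (hB0 : 0 < B) (hνB : ν.real Set.univ ≤ B)
    (hB : ∀ c : ι → ℂ, ∫ ω, ‖∑ j, c j * u j ω‖ ^ (2 : ℝ) ∂ν ≤ B * ∑ j, ‖c j‖ ^ (2 : ℝ))
    {s : ℝ} (hs : 1 < s) (c : ι → ℂ) :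
    ∫ ω, ‖∑ j, c j * u j ω‖ ^ s ∂ν ≤
      B * (∑ j, ‖c j‖ ^ min s (s / (s - 1))) ^ (s / min s (s / (s - 1))) := by
  have e0 : 0 < s - 1 := by linarith
  rcases lt_or_ge 2 s with h2 | h2
  · have : min s (s / (s - 1)) = s / (s - 1) := by
      refine min_eq_right ?_
      rw [div_le_iff₀ e0]
      nlinarith
    rw [this]
    refine (integral_norm_sum_mul_rpow_le_of_two_lt hu hu1 hB0 hνB hB h2 c).trans_eq ?_
    congr 2
    field_simp
  · have : min s (s / (s - 1)) = s := by
      refine min_eq_left ?_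
      rw [le_div_iff₀ e0]
      nlinarith
    rw [this, div_self (by linarith), Real.rpow_one]
    set N := ∑ j, ‖c j‖ ^ s with hN
    have hN0 : 0 ≤ N := Finset.sum_nonneg fun j _ => by positivity
    rcases hN0.eq_or_lt with h0 | h0
    · have hc : ∀ j, c j = 0 := by
        intro j
        have := (Finset.sum_eq_zero_iff_of_nonneg (fun j _ => by positivity)).1 h0.symm j
          (Finset.mem_univ j)
        simpa [Real.rpow_eq_zero (norm_nonneg _) (by linarith : s ≠ 0)] using this
      simp [hc, ← h0, Real.zero_rpow (by linarith : s ≠ 0)]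
    have hN2 : ∑ j, ‖c j‖ ^ (2 : ℝ) ≤ N ^ (2 / s) := by
      have hle : ∀ j, ‖c j‖ ^ s ≤ N := fun j =>
        Finset.single_le_sum (f := fun j => ‖c j‖ ^ s) (fun i _ => by positivity)
          (Finset.mem_univ j)
      calc ∑ j, ‖c j‖ ^ (2 : ℝ) ≤ ∑ j, N ^ (2 / s - 1) * ‖c j‖ ^ s := by
            refine Finset.sum_le_sum fun j _ => ?_
            have h3 : ‖c j‖ ^ (2 : ℝ) = (‖c j‖ ^ s) ^ (2 / s - 1) * ‖c j‖ ^ s := by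
              rcases (norm_nonneg (c j)).eq_or_lt with h4 | h4
              · rw [← h4, Real.zero_rpow two_ne_zero, Real.zero_rpow (by linarith : s ≠ 0), mul_zero]
              · rw [← Real.rpow_mul h4.le, ← Real.rpow_add h4]
                congr 1
                field_simp
                ring
            rw [h3]
            gcongr
            · rw [sub_nonneg, le_div_iff₀ (by linarith)]; linarith
            · exact hle j
        _ = _ := by
            rw [← Finset.mul_sum, ← hN, ← Real.rpow_add_one h0.ne']
            congr 1
            ring
    -- Young's inequality with weights `s / 2`, `1 - s / 2`, balanced where `t ^ s = N`
    have hpt : ∀ t : ℝ, 0 ≤ t →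
        t ^ s ≤ s / 2 * (N ^ (1 - 2 / s) * t ^ (2 : ℝ)) + (1 - s / 2) * N := by
      intro t ht
      have h3 := Real.geom_mean_le_arith_mean2_weighted (w₁ := s / 2) (w₂ := 1 - s / 2)
        (p₁ := N ^ (1 - 2 / s) * t ^ (2 : ℝ)) (p₂ := N) (by linarith) (by linarith)
        (by positivity) h0.le (by ring)
      refine le_trans (le_of_eq ?_) h3
      rw [Real.mul_rpow (by positivity) (by positivity), ← Real.rpow_mul h0.le,
        ← Real.rpow_mul ht, mul_right_comm, ← Real.rpow_add h0,
        show (1 - 2 / s) * (s / 2) + (1 - s / 2) = 0 by field_simp; ring,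
        Real.rpow_zero, one_mul]
      congr 1
      ring
    have hi := integrable_norm_sum_mul_rpow hu hu1 c zero_le_two (ν := ν)
    calc ∫ ω, ‖∑ j, c j * u j ω‖ ^ s ∂ν
        ≤ ∫ ω, (s / 2 * (N ^ (1 - 2 / s) * ‖∑ j, c j * u j ω‖ ^ (2 : ℝ)) + (1 - s / 2) * N) ∂ν := by
          refine integral_mono (integrable_norm_sum_mul_rpow hu hu1 c (by linarith))
            (((hi.const_mul _).const_mul _).add (integrable_const _)) fun ω => hpt _ (norm_nonneg _)
      _ = s / 2 * (N ^ (1 - 2 / s) * ∫ ω, ‖∑ j, c j * u j ω‖ ^ (2 : ℝ) ∂ν) +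
          ν.real Set.univ * ((1 - s / 2) * N) := by
          rw [integral_add ((hi.const_mul _).const_mul _) (integrable_const _), integral_const_mul,
            integral_const_mul, integral_const, smul_eq_mul]
      _ ≤ s / 2 * (N ^ (1 - 2 / s) * (B * N ^ (2 / s))) + B * ((1 - s / 2) * N) := by
          have h5 : 0 ≤ 1 - s / 2 := by linarith
          have h6 := (hB c).trans (mul_le_mul_of_nonneg_left hN2 hB0.le)
          gcongr
      _ = B * N := by
          have : N ^ (1 - 2 / s) * N ^ (2 / s) = N := by
            rw [← Real.rpow_add h0, sub_add_cancel, Real.rpow_one]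
          calc _ = s / 2 * B * (N ^ (1 - 2 / s) * N ^ (2 / s)) + B * ((1 - s / 2) * N) := by ring
            _ = _ := by rw [this]; ring

end HausdorffYoung

/-! ### Uniform convexity of `L^p` -/

section UniformConvexity

theorem norm_half_add_rpow_lt {s : ℝ} (hs : 1 < s) {a b : ℂ} (hab : a ≠ b) :
    ‖(a + b) / 2‖ ^ s < (‖a‖ ^ s + ‖b‖ ^ s) / 2 := by
  have h2 : ‖(a + b) / 2‖ = ‖a + b‖ / 2 := by simp
  rw [h2]
  by_cases hn : ‖a‖ = ‖b‖
  · have h3 : ‖a + b‖ < ‖a‖ + ‖b‖ := by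
      refine (norm_add_le a b).lt_of_ne fun h => hab ?_
      exact (sameRay_iff_of_norm_eq hn).1 (sameRay_iff_norm_add.2 h)
    have h4 : ‖a + b‖ / 2 < ‖b‖ := by rw [hn] at h3; linarith
    have h5 := Real.rpow_lt_rpow (by positivity) h4 (by linarith : 0 < s)
    rw [hn]
    linarith
  · have h3 := (strictConvexOn_rpow hs).2 (norm_nonneg a) (norm_nonneg b) hn
      (by norm_num : (0 : ℝ) < 1 / 2) (by norm_num : (0 : ℝ) < 1 / 2) (by norm_num)
    simp only [smul_eq_mul] at h3
    calc _ ≤ (1 / 2 * ‖a‖ + 1 / 2 * ‖b‖) ^ s := by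
          refine Real.rpow_le_rpow (by positivity) ?_ (by linarith)
          linarith [norm_add_le a b]
      _ < 1 / 2 * ‖a‖ ^ s + 1 / 2 * ‖b‖ ^ s := h3
      _ = _ := by ring

/-- A quantitative form of the strict convexity of `|·| ^ s`, by compactness of
`{(a, b) : |a| ^ s + |b| ^ s = 1}` and homogeneity. -/
theorem exists_norm_sub_rpow_le {s : ℝ} (hs : 1 < s) {ε : ℝ} (hε : 0 < ε) :
    ∃ C : ℝ, 0 < C ∧ ∀ a b : ℂ, ‖a - b‖ ^ s ≤ ε * (‖a‖ ^ s + ‖b‖ ^ s) +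
      C * ((‖a‖ ^ s + ‖b‖ ^ s) / 2 - ‖(a + b) / 2‖ ^ s) := by
  have hs0 : 0 < s := by linarith
  let D : ℂ × ℂ → ℝ := fun z => (‖z.1‖ ^ s + ‖z.2‖ ^ s) / 2 - ‖(z.1 + z.2) / 2‖ ^ s
  have hr : ∀ g : ℂ × ℂ → ℂ, Continuous g → Continuous fun z => ‖g z‖ ^ s := fun g hg =>
    hg.norm.rpow_const fun _ => Or.inr hs0.le
  have hDc : Continuous D :=
    (((hr _ continuous_fst).add (hr _ continuous_snd)).div_const 2).sub
      (hr _ ((continuous_fst.add continuous_snd).div_const 2))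
  have hD0 : ∀ a b, 0 ≤ D (a, b) := by
    intro a b
    by_cases h : a = b
    · subst h
      have : ‖(a + a) / 2‖ = ‖a‖ := by rw [← two_mul]; simp
      simp only [D, this]
      linarith
    · exact (sub_pos.2 (norm_half_add_rpow_lt hs h)).le
  let T : Set (ℂ × ℂ) := {z | ‖z.1‖ ^ s + ‖z.2‖ ^ s = 1} ∩ {z | ε ≤ ‖z.1 - z.2‖ ^ s}
  have hle1 : ∀ z : ℂ × ℂ, ‖z.1‖ ^ s + ‖z.2‖ ^ s = 1 → ‖z.1‖ ≤ 1 ∧ ‖z.2‖ ≤ 1 := by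
    intro z hz
    have h1 : 0 ≤ ‖z.1‖ ^ s := by positivity
    have h2 : 0 ≤ ‖z.2‖ ^ s := by positivity
    constructor <;>
    · by_contra! h
      linarith [Real.one_lt_rpow h hs0]
  have hT : IsCompact T := by
    refine Metric.isCompact_of_isClosed_isBounded
      ((isClosed_eq ((hr _ continuous_fst).add (hr _ continuous_snd)) continuous_const).inter
        (isClosed_le continuous_const (hr _ (continuous_fst.sub continuous_snd)))) ?_
    refine Metric.isBounded_closedBall (x := (0 : ℂ × ℂ)) (r := 1) |>.subset fun z hz => ?_
    rw [mem_closedBall_zero_iff, Prod.norm_def]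
    exact max_le (hle1 z hz.1).1 (hle1 z hz.1).2
  obtain ⟨c, hc0, hc⟩ : ∃ c : ℝ, 0 < c ∧ ∀ z ∈ T, c ≤ D z := by
    rcases T.eq_empty_or_nonempty with h | h
    · exact ⟨1, one_pos, by simp [h]⟩
    · obtain ⟨z, hz, hmin⟩ := hT.exists_isMinOn h hDc.continuousOn
      refine ⟨D z, sub_pos.2 (norm_half_add_rpow_lt hs fun h => ?_), fun w hw => hmin hw⟩
      have := hz.2
      rw [Set.mem_ofPred_eq, h, sub_self, norm_zero, Real.zero_rpow hs0.ne'] at this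
      linarith
  have hunit : ∀ a b : ℂ, ‖a‖ ^ s + ‖b‖ ^ s = 1 → ‖a - b‖ ^ s ≤ ε + 2 ^ s / c * D (a, b) := by
    intro a b hab
    have hD := hD0 a b
    have h2 : (0 : ℝ) < 2 ^ s := by positivity
    rcases le_or_gt ε (‖a - b‖ ^ s) with h | h
    · have h3 := hc (a, b) ⟨hab, h⟩
      have h4 : ‖a - b‖ ^ s ≤ 2 ^ s := by
        refine Real.rpow_le_rpow (norm_nonneg _) ?_ hs0.le
        have := hle1 (a, b) hab
        linarith [norm_sub_le a b, this.1, this.2]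
      have h5 : 2 ^ s / c * c ≤ 2 ^ s / c * D (a, b) := by gcongr
      rw [div_mul_cancel₀ _ hc0.ne'] at h5
      linarith
    · have : 0 ≤ 2 ^ s / c * D (a, b) := by positivity
      linarith
  refine ⟨2 ^ s / c, by positivity, fun a b => ?_⟩
  set N := ‖a‖ ^ s + ‖b‖ ^ s with hN
  have ha0 : 0 ≤ ‖a‖ ^ s := by positivity
  have hb0 : 0 ≤ ‖b‖ ^ s := by positivity
  rcases (add_nonneg ha0 hb0).eq_or_lt with h0 | h0
  · have ha : a = 0 := by
      have : ‖a‖ ^ s = 0 := by linarith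
      simpa [Real.rpow_eq_zero (norm_nonneg _) hs0.ne'] using this
    have hb : b = 0 := by
      have : ‖b‖ ^ s = 0 := by linarith
      simpa [Real.rpow_eq_zero (norm_nonneg _) hs0.ne'] using this
    simp [hN, ha, hb, Real.zero_rpow hs0.ne']
  · rw [← hN] at h0
    set r : ℝ := N ^ (-s⁻¹) with hrdef
    have hr0 : 0 < r := Real.rpow_pos_of_pos h0 _
    have hrs : r ^ s = N⁻¹ := by
      rw [hrdef, ← Real.rpow_mul h0.le, neg_mul, inv_mul_cancel₀ hs0.ne', Real.rpow_neg_one]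
    have hn : ∀ z : ℂ, ‖(r : ℂ) * z‖ ^ s = N⁻¹ * ‖z‖ ^ s := by
      intro z
      rw [norm_mul, Complex.norm_real, Real.norm_of_nonneg hr0.le,
        Real.mul_rpow hr0.le (norm_nonneg _), hrs]
    have h1 := hunit (r * a) (r * b) (by rw [hn, hn, ← mul_add, ← hN, inv_mul_cancel₀ h0.ne'])
    simp only [D] at h1
    rw [← mul_sub, ← mul_add, mul_div_assoc, hn, hn, hn, hn, ← mul_add, ← hN] at h1
    have h2 := mul_le_mul_of_nonneg_left h1 h0.le
    have h3 : N * (N⁻¹ * ‖a - b‖ ^ s) = ‖a - b‖ ^ s := by field_simp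
    rw [h3] at h2
    refine h2.trans_eq ?_
    field_simp

variable {Ω : Type*} [MeasurableSpace Ω] {μ : Measure Ω} {p : ℝ≥0∞} [Fact (1 ≤ p)]

theorem norm_rpow_eq_integral {G : Type*} [NormedAddCommGroup G] (hp : p ≠ ∞) (f : Lp G p μ) :
    ‖f‖ ^ p.toReal = ∫ ω, ‖f ω‖ ^ p.toReal ∂μ := by
  have hp0 : p ≠ 0 := (zero_lt_one.trans_le (Fact.out : 1 ≤ p)).ne'
  have hP : 0 < p.toReal := ENNReal.toReal_pos hp0 hp
  have h0 : 0 ≤ ∫ ω, ‖f ω‖ ^ p.toReal ∂μ := integral_nonneg fun ω => by positivity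
  rw [Lp.norm_def, (Lp.memLp f).eLpNorm_eq_integral_rpow_norm hp0 hp,
    ENNReal.toReal_ofReal (by positivity), ← Real.rpow_mul h0, inv_mul_cancel₀ hP.ne',
    Real.rpow_one]

/-- Clarkson's theorem for `1 < p < ∞`. -/
theorem uniformConvexSpace_Lp (hp1 : 1 < p) (hp : p ≠ ∞) : UniformConvexSpace (Lp ℂ p μ) := by
  have hp0 : p ≠ 0 := (zero_lt_one.trans hp1).ne'
  have hP1 : 1 < p.toReal := by
    rw [← ENNReal.toReal_one]
    exact (ENNReal.toReal_lt_toReal ENNReal.one_ne_top hp).2 hp1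
  set s := p.toReal with hs
  have hs0 : 0 < s := by linarith
  refine ⟨fun ε hε => ?_⟩
  obtain ⟨C, hC0, hC⟩ := exists_norm_sub_rpow_le hP1 (ε := ε ^ s / 4) (by positivity)
  have hδ : ∃ δ : ℝ, 0 < δ ∧ δ ≤ 2 ∧ 1 - ε ^ s / (4 * C) < (1 - δ / 2) ^ s := by
    have h1 : Tendsto (fun δ : ℝ => (1 - δ / 2) ^ s) (𝓝[>] 0) (𝓝 ((1 - 0 / 2) ^ s)) := by
      have : Continuous fun δ : ℝ => (1 - δ / 2) ^ s :=
        (continuous_const.sub (continuous_id.div_const 2)).rpow_const fun _ => Or.inr hs0.le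
      exact (this.tendsto 0).mono_left nhdsWithin_le_nhds
    rw [zero_div, sub_zero, Real.one_rpow] at h1
    have h2 : 1 - ε ^ s / (4 * C) < 1 := by
      have : 0 < ε ^ s / (4 * C) := by positivity
      linarith
    obtain ⟨δ, h3, h4, h5⟩ := ((h1.eventually (lt_mem_nhds h2)).and
      (Ioc_mem_nhdsGT (zero_lt_two' ℝ))).exists
    exact ⟨δ, h4, h5, h3⟩
  obtain ⟨δ, hδ0, hδ2, hδ⟩ := hδ
  refine ⟨δ, hδ0, fun f hf g hg hfg => ?_⟩
  by_contra! hlt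
  have hif : Integrable (fun ω => ‖f ω‖ ^ s) μ := (Lp.memLp f).integrable_norm_rpow hp0 hp
  have hig : Integrable (fun ω => ‖g ω‖ ^ s) μ := (Lp.memLp g).integrable_norm_rpow hp0 hp
  set h : Lp ℂ p μ := (2⁻¹ : ℂ) • (f + g) with hh
  have hih : Integrable (fun ω => ‖h ω‖ ^ s) μ := (Lp.memLp h).integrable_norm_rpow hp0 hp
  have hhn : ‖h‖ = ‖f + g‖ / 2 := by rw [hh, norm_smul]; simp; ring
  have hheq : ∀ᵐ ω ∂μ, h ω = (f ω + g ω) / 2 := by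
    filter_upwards [Lp.coeFn_smul (2⁻¹ : ℂ) (f + g), Lp.coeFn_add f g] with ω h1 h2
    rw [hh, h1, Pi.smul_apply, h2, Pi.add_apply, smul_eq_mul]
    ring
  have hint : ‖f - g‖ ^ s ≤ ε ^ s / 4 * (‖f‖ ^ s + ‖g‖ ^ s) +
      C * ((‖f‖ ^ s + ‖g‖ ^ s) / 2 - ‖h‖ ^ s) := by
    have hi1 : Integrable (fun ω => ε ^ s / 4 * (‖f ω‖ ^ s + ‖g ω‖ ^ s)) μ :=
      (hif.add hig).const_mul _
    have hi2 : Integrable (fun ω => (‖f ω‖ ^ s + ‖g ω‖ ^ s) / 2) μ := (hif.add hig).div_const 2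
    have hi3 : Integrable (fun ω => C * ((‖f ω‖ ^ s + ‖g ω‖ ^ s) / 2 - ‖h ω‖ ^ s)) μ :=
      (hi2.sub hih).const_mul C
    have h0 : ∫ ω, ‖(f - g) ω‖ ^ s ∂μ ≤ ∫ ω, (ε ^ s / 4 * (‖f ω‖ ^ s + ‖g ω‖ ^ s) +
        C * ((‖f ω‖ ^ s + ‖g ω‖ ^ s) / 2 - ‖h ω‖ ^ s)) ∂μ := by
      refine integral_mono_ae ((Lp.memLp (f - g)).integrable_norm_rpow hp0 hp) (hi1.add hi3) ?_
      filter_upwards [hheq, Lp.coeFn_sub f g] with ω h1 h2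
      have := hC (f ω) (g ω)
      simpa only [h1, h2, Pi.sub_apply] using this
    rw [integral_add hi1 hi3, integral_const_mul, integral_const_mul, integral_sub hi2 hih,
      integral_div, integral_add hif hig] at h0
    rwa [← norm_rpow_eq_integral hp, ← norm_rpow_eq_integral hp, ← norm_rpow_eq_integral hp,
      ← norm_rpow_eq_integral hp] at h0
  rw [hf, hg, hhn] at hint
  have h3 : ε ^ s ≤ ‖f - g‖ ^ s := Real.rpow_le_rpow hε.le hfg hs0.le
  have h4 : (1 - δ / 2) ^ s ≤ (‖f + g‖ / 2) ^ s := by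
    refine Real.rpow_le_rpow (by linarith) (by linarith) hs0.le
  have h5 : 1 - (‖f + g‖ / 2) ^ s < ε ^ s / (4 * C) := by linarith
  have h6 : C * (1 - (‖f + g‖ / 2) ^ s) < ε ^ s / 4 := by
    have := mul_lt_mul_of_pos_left h5 hC0
    refine this.trans_eq ?_
    field_simp
  simp only [Real.one_rpow] at hint
  have h7 : 0 < ε ^ s := by positivity
  have h8 : C * ((1 + 1) / 2 - (‖f + g‖ / 2) ^ s) = C * (1 - (‖f + g‖ / 2) ^ s) := by norm_num
  rw [h8] at hint
  linarith

end UniformConvexity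

/-! ### Weak limits along ultrafilters -/

section WeakLimits

variable {E : Type*} [NormedAddCommGroup E] [NormedSpace ℂ E] {ι : Type*}

/-- Weak convergence of `f` to `φ` along the filter `U`. -/
def WeakTendsto (f : ι → E) (U : Filter ι) (φ : E) : Prop :=
  ∀ ℓ : E →L[ℂ] ℂ, Tendsto (fun n => ℓ (f n)) U (𝓝 (ℓ φ))

variable {U : Filter ι} {f : ι → E} {φ : E}

theorem WeakTendsto.unique [U.NeBot] {ψ : E} (hφ : WeakTendsto f U φ) (hψ : WeakTendsto f U ψ) :
    φ = ψ :=
  (SeparatingDual.eq_iff_forall_dual_eq (R := ℂ)).2 fun ℓ => tendsto_nhds_unique (hφ ℓ) (hψ ℓ)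

theorem WeakTendsto.norm_le [U.NeBot] (hφ : WeakTendsto f U φ) {R : ℝ}
    (hR : ∀ n, ‖f n‖ ≤ R) : ‖φ‖ ≤ R := by
  obtain ⟨ℓ, hℓ1, hℓ⟩ := exists_dual_vector'' ℂ φ
  have h1 := (hφ ℓ).norm
  have h2 : ‖ℓ φ‖ = ‖φ‖ := by rw [hℓ]; simp
  rw [h2] at h1
  refine le_of_tendsto h1 (Eventually.of_forall fun n => ?_)
  exact (ℓ.le_of_opNorm_le hℓ1 _).trans (by rw [one_mul]; exact hR n)

theorem WeakTendsto.map {E' : Type*} [NormedAddCommGroup E'] [NormedSpace ℂ E']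
    (hφ : WeakTendsto f U φ) (T : E →L[ℂ] E') : WeakTendsto (fun n => T (f n)) U (T φ) :=
  fun ℓ => hφ (ℓ.comp T)

theorem WeakTendsto.congr_of_tendsto_sub {g : ι → E} (hφ : WeakTendsto f U φ)
    (h : Tendsto (fun n => g n - f n) U (𝓝 0)) : WeakTendsto g U φ := by
  intro ℓ
  have h1 := (hφ ℓ).add ((ℓ.continuous.tendsto 0).comp h)
  simpa using h1

/-- The Radon-Riesz property of uniformly convex spaces. -/
theorem WeakTendsto.tendsto [U.NeBot] [UniformConvexSpace E] (hφ : WeakTendsto f U φ)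
    (hf : ∀ n, ‖f n‖ ≤ 1) (hφ1 : 1 ≤ ‖φ‖) : Tendsto f U (𝓝 φ) := by
  rw [Metric.tendsto_nhds]
  intro ε hε
  obtain ⟨δ, hδ0, hδ⟩ := exists_forall_closed_ball_dist_add_le_two_sub E hε
  obtain ⟨ℓ, hℓ1, hℓ⟩ := exists_dual_vector'' ℂ φ
  have hφle := hφ.norm_le hf
  have h1 : Tendsto (fun n => ‖ℓ (f n + φ)‖) U (𝓝 (‖φ‖ + ‖φ‖)) := by
    have := ((hφ ℓ).add_const (ℓ φ)).norm
    have h2 : ‖ℓ φ + ℓ φ‖ = ‖φ‖ + ‖φ‖ := by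
      rw [hℓ, ← two_mul, norm_mul]
      simp
      ring
    rw [h2] at this
    simpa only [map_add] using this
  filter_upwards [h1.eventually (lt_mem_nhds (by linarith : 2 - δ < ‖φ‖ + ‖φ‖))] with n hn
  by_contra! h3
  have h4 := hδ (hf n) hφle (by rwa [← dist_eq_norm])
  have h5 : ‖ℓ (f n + φ)‖ ≤ ‖f n + φ‖ := by
    simpa using ℓ.le_of_opNorm_le hℓ1 (f n + φ)
  linarith

/-- Bounded families in a uniformly convex Banach space converge weakly along ultrafilters. The
weak limit is the common point of the closed convex hulls of the sets `f '' A`, `A ∈ U`: their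
points of almost minimal norm form a Cauchy filter. -/
theorem exists_weakTendsto [CompleteSpace E] [UniformConvexSpace E] (U : Ultrafilter ι)
    {f : ι → E} {R : ℝ} (hf : ∀ n, ‖f n‖ ≤ R) : ∃ φ : E, WeakTendsto f U φ := by
  let H : Set ι → Set E := fun A => closedConvexHull ℝ (f '' A)
  have hHc : ∀ A, Convex ℝ (H A) := fun A => convex_closedConvexHull
  have hHcl : ∀ A, IsClosed (H A) := fun A => isClosed_closedConvexHull
  have hHmono : ∀ {A B}, A ⊆ B → H A ⊆ H B := fun h =>
    (closedConvexHull ℝ).monotone (Set.image_mono h)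
  have hHsub : ∀ A, f '' A ⊆ H A := fun A => subset_closedConvexHull
  -- `m` is the supremum of the distances of the hulls to the origin
  let D : Set ℝ := {t | ∃ A ∈ U, ∀ x ∈ H A, t ≤ ‖x‖}
  have hDR : ∀ t ∈ D, t ≤ R := by
    rintro t ⟨A, hA, ht⟩
    obtain ⟨n, hn⟩ := U.nonempty_of_mem hA
    exact (ht _ (hHsub A ⟨n, hn, rfl⟩)).trans (hf n)
  have hD0 : (0 : ℝ) ∈ D := ⟨Set.univ, univ_mem, fun x _ => norm_nonneg x⟩
  have hDbdd : BddAbove D := ⟨R, hDR⟩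
  set m := sSup D with hm
  have hm0 : 0 ≤ m := le_csSup hDbdd hD0
  have hlow : ∀ η > 0, ∃ A ∈ U, ∀ x ∈ H A, m - η ≤ ‖x‖ := by
    intro η hη
    obtain ⟨t, ⟨A, hA, ht⟩, htm⟩ := exists_lt_of_lt_csSup ⟨0, hD0⟩ (by linarith : m - η < sSup D)
    exact ⟨A, hA, fun x hx => htm.le.trans (ht x hx)⟩
  have hup : ∀ η > 0, ∀ A ∈ U, ∃ x ∈ H A, ‖x‖ ≤ m + η := by
    intro η hη A hA
    by_contra! h
    have : m + η ∈ D := ⟨A, hA, fun x hx => (h x hx).le⟩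
    linarith [le_csSup hDbdd this]
  have hdiam : ∀ ε > 0, ∃ η > 0, ∃ A ∈ U, ∀ x ∈ H A, ∀ y ∈ H A, ‖x‖ ≤ m + η → ‖y‖ ≤ m + η →
      ‖x - y‖ < ε := by
    intro ε hε
    rcases hm0.eq_or_lt with h0 | h0
    · refine ⟨ε / 3, by positivity, Set.univ, univ_mem, fun x _ y _ hx hy => ?_⟩
      linarith [norm_sub_le x y]
    obtain ⟨δ, hδ0, hδ⟩ := exists_forall_closed_ball_dist_add_le_two_sub E
      (ε := ε / (m + 1)) (by positivity)
    set η := min 1 (m * δ / 8) with hη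
    have hη0 : 0 < η := by positivity
    obtain ⟨A, hA, hAm⟩ := hlow η hη0
    refine ⟨η, hη0, A, hA, fun x hx y hy hxm hym => ?_⟩
    by_contra! hxy
    have hr : 0 < m + η := by linarith
    have hn : ∀ z : E, ‖(m + η)⁻¹ • z‖ = (m + η)⁻¹ * ‖z‖ := fun z =>
      norm_smul_of_nonneg (by positivity) z
    have hle : ∀ z : E, ‖z‖ ≤ m + η → ‖(m + η)⁻¹ • z‖ ≤ 1 := by
      intro z hz
      rw [hn, inv_mul_le_iff₀ hr, mul_one]
      exact hz
    have h1 := hδ (hle x hxm) (hle y hym) (by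
      rw [← smul_sub, hn, div_eq_inv_mul]
      gcongr
      exact min_le_left _ _)
    rw [← smul_add, hn, inv_mul_le_iff₀ hr] at h1
    have hmid : (2⁻¹ : ℝ) • (x + y) ∈ H A := by
      rw [smul_add]
      exact hHc A hx hy (by norm_num) (by norm_num) (by norm_num)
    have h2 := hAm _ hmid
    rw [norm_smul_of_nonneg (by norm_num)] at h2
    have h3 : η ≤ m * δ / 8 := min_le_right _ _
    have h4 : 0 < η * δ := by positivity
    have h5 : 0 < m * δ := by positivity
    nlinarith
  choose η hη A hA hd using fun k : ℕ => hdiam (1 / ((k : ℝ) + 1)) (by positivity)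
  choose x hx hxm using fun k => hup (η k) (hη k) (A k) (hA k)
  have hxx : ∀ k l, dist (x k) (x l) < 1 / ((k : ℝ) + 1) + 1 / ((l : ℝ) + 1) := by
    intro k l
    obtain ⟨z, hz, hzm⟩ := hup (min (η k) (η l)) (lt_min (hη k) (hη l)) (A k ∩ A l)
      (inter_mem (hA k) (hA l))
    have h1 := hd k (x k) (hx k) z (hHmono Set.inter_subset_left hz) (hxm k)
      (hzm.trans (by gcongr; exact min_le_left _ _))
    have h2 := hd l (x l) (hx l) z (hHmono Set.inter_subset_right hz) (hxm l)
      (hzm.trans (by gcongr; exact min_le_right _ _))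
    rw [← dist_eq_norm] at h1 h2
    exact (dist_triangle_right _ _ z).trans_lt (add_lt_add h1 h2)
  have hcauchy : CauchySeq x := by
    refine cauchySeq_of_le_tendsto_0 (fun N : ℕ => 2 * (1 / ((N : ℝ) + 1))) (fun k l N hk hl => ?_) ?_
    · have h1 : 1 / ((k : ℝ) + 1) ≤ 1 / ((N : ℝ) + 1) := by gcongr
      have h2 : 1 / ((l : ℝ) + 1) ≤ 1 / ((N : ℝ) + 1) := by gcongr
      linarith [hxx k l]
    · simpa using (tendsto_one_div_add_atTop_nhds_zero_nat (𝕜 := ℝ)).const_mul 2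
  obtain ⟨φ, hφ⟩ := cauchySeq_tendsto_of_complete hcauchy
  have hφH : ∀ A' ∈ U, φ ∈ H A' := by
    intro A' hA'
    choose z hz hzm using fun k => hup (η k) (hη k) (A' ∩ A k) (inter_mem hA' (hA k))
    have h1 : Tendsto z atTop (𝓝 φ) := by
      refine tendsto_of_tendsto_of_dist hφ (squeeze_zero (fun _ => dist_nonneg) (fun k => ?_)
        (tendsto_one_div_add_atTop_nhds_zero_nat (𝕜 := ℝ)))
      rw [dist_eq_norm]
      exact (hd k (x k) (hx k) (z k) (hHmono Set.inter_subset_right (hz k)) (hxm k) (hzm k)).le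
    exact (hHcl A').mem_of_tendsto h1
      (Eventually.of_forall fun k => hHmono Set.inter_subset_left (hz k))
  refine ⟨φ, fun ℓ => ?_⟩
  obtain ⟨c, -, hc⟩ := (isCompact_closedBall (0 : ℂ) (‖ℓ‖ * R)).ultrafilter_le_nhds
    (U.map fun n => ℓ (f n)) (by
      rw [le_principal_iff]
      refine Ultrafilter.mem_map.2 (Eventually.of_forall fun n => ?_)
      refine mem_closedBall_zero_iff.2 ?_
      exact (ℓ.le_opNorm _).trans (by gcongr; exact hf n))
  have hc' : Tendsto (fun n => ℓ (f n)) U (𝓝 c) := hc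
  have : ℓ φ = c := by
    refine eq_of_forall_dist_le fun ε hε => ?_
    have h1 : {n | ℓ (f n) ∈ Metric.closedBall c ε} ∈ U :=
      hc' (Metric.closedBall_mem_nhds c hε)
    have h2 : H {n | ℓ (f n) ∈ Metric.closedBall c ε} ⊆ ℓ ⁻¹' Metric.closedBall c ε := by
      refine closedConvexHull_min ?_ ?_ (Metric.isClosed_closedBall.preimage ℓ.continuous)
      · rintro _ ⟨n, hn, rfl⟩
        exact hn
      · exact (convex_closedBall c ε).linear_preimage (ℓ.restrictScalars ℝ : E →ₗ[ℝ] ℂ)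
    exact h2 (hφH _ h1)
  rwa [this]

end WeakLimits

/-! ### The extension operator and modulations -/

section Basics

variable {d : ℕ} {p q : ℝ≥0∞}

instance : IsFiniteMeasure (surf d) := inferInstanceAs (IsFiniteMeasure (Measure.toSphere _))

theorem surf_ne_zero (d : ℕ) : surf d ≠ 0 := Measure.toSphere_ne_zero _

theorem norm_coe_sph (ω : Sph d) : ‖(ω : Space d)‖ = 1 := mem_sphere_zero_iff_norm.1 ω.2

theorem norm_character_sub_le (x y : Space d) (ω : Sph d) :
    ‖character x ω - character y ω‖ ≤ ‖x - y‖ := by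
  have h : character x ω - character y ω =
      character y ω * (Complex.exp (Complex.I * (inner ℝ (x - y) (ω : Space d) : ℝ)) - 1) := by
    rw [character, character, mul_sub, ← Complex.exp_add, mul_one, ← mul_add, inner_sub_left]
    congr 3
    push_cast
    ring
  rw [h, norm_mul, norm_character, one_mul]
  refine (Real.norm_exp_I_mul_ofReal_sub_one_le (x := inner ℝ (x - y) (ω : Space d))).trans ?_
  refine (norm_inner_le_norm _ _).trans ?_
  rw [norm_coe_sph, mul_one]

theorem character_add (x y : Space d) (ω : Sph d) :
    character (x + y) ω = character x ω * character y ω := by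
  rw [character, character, character, ← Complex.exp_add, ← mul_add, inner_add_left]
  push_cast
  rfl

theorem integrable_character_mul {f : Sph d → ℂ} (hf : Integrable f (surf d)) (x : Space d) :
    Integrable (fun ω => character x ω * f ω) (surf d) := by
  refine hf.mono ((continuous_character x).aestronglyMeasurable.mul hf.1)
    (Eventually.of_forall fun ω => ?_)
  rw [norm_mul, norm_character, one_mul]

theorem norm_extend_le (f : Sph d → ℂ) (x : Space d) :
    ‖extend f x‖ ≤ ∫ ω, ‖f ω‖ ∂(surf d) := by
  refine (norm_integral_le_integral_norm _).trans_eq ?_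
  simp only [norm_mul, norm_character, one_mul]

theorem norm_extend_sub_le {f : Sph d → ℂ} (hf : Integrable f (surf d)) (x y : Space d) :
    ‖extend f x - extend f y‖ ≤ (∫ ω, ‖f ω‖ ∂(surf d)) * ‖x - y‖ := by
  rw [extend, extend, ← integral_sub (integrable_character_mul hf x)
    (integrable_character_mul hf y), ← integral_mul_const]
  refine norm_integral_le_of_norm_le (hf.norm.mul_const _) (Eventually.of_forall fun ω => ?_)
  rw [← sub_mul, norm_mul, mul_comm]
  gcongr
  exact norm_character_sub_le x y ω

theorem extend_congr_ae {f g : Sph d → ℂ} (h : f =ᵐ[surf d] g) : extend f = extend g := by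
  ext x
  refine integral_congr_ae ?_
  filter_upwards [h] with ω hω
  rw [hω]

theorem extend_const_mul (c : ℂ) (f : Sph d → ℂ) :
    extend (fun ω => c * f ω) = fun x => c * extend f x := by
  ext x
  rw [extend, extend, ← integral_const_mul]
  congr 1
  ext ω
  ring

theorem eLpNorm_extend_le {f : Sph d → ℂ} (hp : p ≠ 0) (hf : MemLp f p (surf d)) :
    eLpNorm (extend f) q volume ≤ opNorm d p q * eLpNorm f p (surf d) := by
  rcases eq_or_ne (eLpNorm f p (surf d)) 0 with h0 | h0
  · have h1 : f =ᵐ[surf d] 0 := (eLpNorm_eq_zero_iff hf.1 hp).1 h0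
    have h2 : extend f = 0 := by
      rw [extend_congr_ae h1]
      ext x
      simp [extend]
    simp [h2]
  set N := (eLpNorm f p (surf d)).toReal with hN
  have hN0 : 0 < N := ENNReal.toReal_pos h0 hf.2.ne
  have hNe : ‖(N : ℂ)‖ₑ = eLpNorm f p (surf d) := by
    rw [← ofReal_norm, Complex.norm_real, Real.norm_of_nonneg hN0.le, hN,
      ENNReal.ofReal_toReal hf.2.ne]
  set g : Sph d → ℂ := fun ω => (N : ℂ)⁻¹ * f ω with hg
  have hgm : MemLp g p (surf d) := hf.const_mul _
  have hfg : f = fun ω => (N : ℂ) * g ω := by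
    ext ω
    rw [hg, mul_inv_cancel_left₀]
    exact_mod_cast hN0.ne'
  have hg1 : eLpNorm g p (surf d) = 1 := by
    have h1 : eLpNorm f p (surf d) = ‖(N : ℂ)‖ₑ * eLpNorm g p (surf d) := by
      conv_lhs => rw [hfg]
      exact eLpNorm_const_smul (N : ℂ) g p (surf d)
    rw [hNe] at h1
    have h2 : eLpNorm f p (surf d) * eLpNorm g p (surf d) = eLpNorm f p (surf d) * 1 := by
      rw [← h1, mul_one]
    exact (ENNReal.mul_right_inj h0 hf.2.ne).1 h2
  have h3 : eLpNorm (extend g) q volume ≤ opNorm d p q :=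
    le_iSup_of_le g (le_iSup_of_le hgm (le_iSup_of_le hg1 le_rfl))
  have h4 : eLpNorm (extend f) q volume = ‖(N : ℂ)‖ₑ * eLpNorm (extend g) q volume := by
    conv_lhs => rw [hfg, extend_const_mul]
    exact eLpNorm_const_smul (N : ℂ) (extend g) q volume
  rw [h4, hNe, mul_comm]
  gcongr

variable (d p) in
/-- The norm of the embedding of `L^p(S^d)` into `L^1(S^d)`. -/
def embConst : ℝ := (surf d Set.univ ^ (1 - 1 / p.toReal)).toReal

theorem embConst_nonneg : 0 ≤ embConst d p := ENNReal.toReal_nonneg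

theorem coeFn_modulate (x : Space d) (f : Lp ℂ p (surf d)) :
    modulate x f =ᵐ[surf d] fun ω => character x ω * f ω :=
  (memLp_character_mul x f).coeFn_toLp

theorem extend_modulate (y : Space d) (f : Lp ℂ p (surf d)) (x : Space d) :
    extend (modulate y f) x = extend f (x + y) := by
  rw [extend_congr_ae (coeFn_modulate y f)]
  refine integral_congr_ae (Eventually.of_forall fun ω => ?_)
  simp only [character_add, mul_assoc]

theorem norm_modulate (x : Space d) (f : Lp ℂ p (surf d)) : ‖modulate x f‖ = ‖f‖ := by
  rw [Lp.norm_def, Lp.norm_def]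
  congr 1
  refine eLpNorm_congr_norm_ae ?_
  filter_upwards [coeFn_modulate x f] with ω h
  rw [h, norm_mul, norm_character, one_mul]

theorem modulate_modulate (x y : Space d) (f : Lp ℂ p (surf d)) :
    modulate x (modulate y f) = modulate (x + y) f := by
  refine Lp.ext ?_
  filter_upwards [coeFn_modulate x (modulate y f), coeFn_modulate y f,
    coeFn_modulate (x + y) f] with ω h1 h2 h3
  rw [h1, h2, h3, character_add, mul_assoc]

theorem norm_modulate_sub_le (x y : Space d) (f : Lp ℂ p (surf d)) :
    ‖modulate x f - modulate y f‖ ≤ ‖x - y‖ * ‖f‖ := by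
  refine Lp.norm_le_mul_norm_of_ae_le_mul ?_
  filter_upwards [Lp.coeFn_sub (modulate x f) (modulate y f), coeFn_modulate x f,
    coeFn_modulate y f] with ω h1 h2 h3
  rw [h1, Pi.sub_apply, h2, h3, ← sub_mul, norm_mul]
  gcongr
  exact norm_character_sub_le x y ω

variable [Fact (1 ≤ p)]

theorem exponent_ne_zero : p ≠ 0 := (zero_lt_one.trans_le (Fact.out : 1 ≤ p)).ne'

theorem integrable_Lp (f : Lp ℂ p (surf d)) : Integrable f (surf d) :=
  (Lp.memLp f).integrable Fact.out

theorem eLpNorm_extend_Lp_le (f : Lp ℂ p (surf d)) :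
    eLpNorm (extend f) q volume ≤ opNorm d p q * ‖f‖ₑ := by
  rw [Lp.enorm_def]
  exact eLpNorm_extend_le exponent_ne_zero (Lp.memLp f)

theorem integral_norm_le (f : Lp ℂ p (surf d)) :
    ∫ ω, ‖f ω‖ ∂(surf d) ≤ embConst d p * ‖f‖ := by
  have h := eLpNorm_le_eLpNorm_mul_rpow_measure_univ (Fact.out : 1 ≤ p)
    (Lp.aestronglyMeasurable f)
  have hexp : (0 : ℝ) ≤ 1 - 1 / p.toReal := by
    rcases eq_or_ne p ∞ with hp | hp
    · simp [hp]
    · have : 1 ≤ p.toReal := by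
        rw [← ENNReal.toReal_one]
        exact ENNReal.toReal_mono hp Fact.out
      rw [sub_nonneg, div_le_one (by linarith)]
      exact this
  have h1 : (eLpNorm f p (surf d) * surf d Set.univ ^ (1 - 1 / p.toReal)) ≠ ∞ :=
    ENNReal.mul_ne_top (Lp.eLpNorm_ne_top f)
      (ENNReal.rpow_ne_top_of_nonneg hexp (measure_ne_top _ _))
  have h2 := ENNReal.toReal_mono h1 (by simpa using h)
  rw [ENNReal.toReal_mul, ← Lp.norm_def, mul_comm] at h2
  refine le_trans (le_of_eq ?_) h2
  rw [eLpNorm_one_eq_lintegral_enorm, integral_norm_eq_lintegral_enorm (Lp.aestronglyMeasurable f)]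

theorem norm_extend_Lp_le (f : Lp ℂ p (surf d)) (x : Space d) :
    ‖extend f x‖ ≤ embConst d p * ‖f‖ :=
  (norm_extend_le f x).trans (integral_norm_le f)

theorem norm_extend_Lp_sub_le (f : Lp ℂ p (surf d)) (x y : Space d) :
    ‖extend f x - extend f y‖ ≤ embConst d p * ‖f‖ * ‖x - y‖ :=
  (norm_extend_sub_le (integrable_Lp f) x y).trans (by gcongr; exact integral_norm_le f)

theorem continuous_extend (f : Lp ℂ p (surf d)) : Continuous (extend f) := by
  refine (LipschitzWith.of_dist_le_mul (K := (embConst d p * ‖f‖).toNNReal) fun x y => ?_).continuous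
  rw [dist_eq_norm, dist_eq_norm,
    Real.coe_toNNReal _ (mul_nonneg embConst_nonneg (norm_nonneg _))]
  exact norm_extend_Lp_sub_le f x y

/-- The functional `f ↦ ℰ f(x)` on `L^p(S^d)`. -/
def extendAt (x : Space d) : Lp ℂ p (surf d) →L[ℂ] ℂ :=
  LinearMap.mkContinuous
    { toFun := fun f => extend f x
      map_add' := fun f g => by
        rw [extend_congr_ae (Lp.coeFn_add f g), extend, extend, extend,
          ← integral_add (integrable_character_mul (integrable_Lp f) x)
            (integrable_character_mul (integrable_Lp g) x)]
        simp only [Pi.add_apply, mul_add]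
      map_smul' := fun c f => by
        rw [extend_congr_ae (Lp.coeFn_smul c f)]
        exact congrFun (extend_const_mul c f) x }
    (embConst d p) fun f => norm_extend_Lp_le f x

theorem extendAt_apply (x : Space d) (f : Lp ℂ p (surf d)) : extendAt x f = extend f x := rfl

/-- Modulation as a bounded operator on `L^p(S^d)`. -/
def modulateL (x : Space d) : Lp ℂ p (surf d) →L[ℂ] Lp ℂ p (surf d) :=
  LinearMap.mkContinuous
    { toFun := modulate x
      map_add' := fun f g => by
        refine Lp.ext ?_
        filter_upwards [coeFn_modulate x (f + g), coeFn_modulate x f, coeFn_modulate x g,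
          Lp.coeFn_add f g, Lp.coeFn_add (modulate x f) (modulate x g)] with ω h1 h2 h3 h4 h5
        rw [h1, h5, h4, Pi.add_apply, Pi.add_apply, h2, h3, mul_add]
      map_smul' := fun c f => by
        refine Lp.ext ?_
        filter_upwards [coeFn_modulate x (c • f), coeFn_modulate x f, Lp.coeFn_smul c f,
          Lp.coeFn_smul c (modulate x f)] with ω h1 h2 h3 h4
        simp only [RingHom.id_apply]
        rw [h1, h4, h3, Pi.smul_apply, Pi.smul_apply, h2, smul_eq_mul, smul_eq_mul]
        ring }
    1 fun f => by
      rw [one_mul]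
      exact (norm_modulate x f).le

theorem opNorm_pos (hq : q ≠ 0) : 0 < opNorm d p q := by
  rw [pos_iff_ne_zero]
  intro h0
  have hm : MemLp (fun _ : Sph d => (1 : ℂ)) p (surf d) := memLp_const 1
  have h1 := eLpNorm_extend_Lp_le (q := q) (hm.toLp _)
  rw [h0, zero_mul, nonpos_iff_eq_zero,
    eLpNorm_eq_zero_iff (continuous_extend _).aestronglyMeasurable hq] at h1
  have h2 := ((continuous_extend _).ae_eq_iff_eq volume continuous_zero).1 h1
  have h3 : extend (fun _ : Sph d => (1 : ℂ)) 0 = 0 := by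
    rw [← extend_congr_ae hm.coeFn_toLp]
    exact congrFun h2 0
  have h4 : (surf d).real Set.univ = 0 := by
    have h5 : ∫ _ : Sph d, (1 : ℂ) ∂(surf d) = 0 := by
      rw [← h3, extend]
      simp [character]
    rw [integral_const] at h5
    simpa using h5
  rw [measureReal_eq_zero_iff, Measure.measure_univ_eq_zero] at h4
  exact surf_ne_zero d h4

end Basics

/-! ### Concentration of Lipschitz functions in `L^s` -/

section Covering

variable {d : ℕ} {p : ℝ≥0∞}

/-- The set where a Lipschitz function in `L^s` is large is covered by a number of unit balls that
depends only on the norms. -/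
theorem exists_card_cover {s : ℝ≥0∞} (hs0 : s ≠ 0) (hs : s ≠ ∞) {C : ℝ≥0∞} (hC : C ≠ ∞) {L δ : ℝ}
    (hL : 0 ≤ L) (hδ : 0 < δ) :
    ∃ N : ℕ, ∀ F : Space d → ℂ, Continuous F → (∀ x y, ‖F x - F y‖ ≤ L * ‖x - y‖) →
      eLpNorm F s volume ≤ C →
      ∃ t : Finset (Space d), t.card ≤ N ∧ ∀ x, δ ≤ ‖F x‖ → ∃ y ∈ t, dist x y ≤ 1 := by
  classical
  set ρ := min (1 / 2) (δ / (2 * (L + 1))) with hρ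
  have hρ0 : 0 < ρ := by positivity
  have hρ1 : ρ ≤ 1 / 2 := min_le_left _ _
  have hρ2 : L * ρ ≤ δ / 2 := by
    calc L * ρ ≤ (L + 1) * (δ / (2 * (L + 1))) := by
          gcongr
          · linarith
          · exact min_le_right _ _
      _ = δ / 2 := by field_simp
  set v : ℝ≥0∞ := volume (Metric.ball (0 : Space d) ρ) with hv
  have hv0 : v ≠ 0 := (Metric.measure_ball_pos volume _ hρ0).ne'
  set ε : ℝ≥0∞ := ENNReal.ofReal (δ / 2) ^ s.toReal with hε
  have hε0 : ε ≠ 0 := by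
    have : ENNReal.ofReal (δ / 2) ≠ 0 := by simpa using hδ
    simp [hε, ENNReal.rpow_eq_zero_iff, hδ]
  have hεt : ε ≠ ∞ := ENNReal.rpow_ne_top_of_nonneg ENNReal.toReal_nonneg ENNReal.ofReal_ne_top
  set M : ℝ≥0∞ := C ^ s.toReal / ε / v with hM
  have hMt : M ≠ ∞ := ENNReal.div_ne_top (ENNReal.div_ne_top
    (ENNReal.rpow_ne_top_of_nonneg ENNReal.toReal_nonneg hC) hε0) hv0
  refine ⟨⌊M.toReal⌋₊, fun F hFc hFL hFC => ?_⟩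
  -- a maximal 1-separated subset of `{δ ≤ |F|}`; around its points `δ / 2 ≤ |F|` on disjoint balls
  let Sep : Finset (Space d) → Prop := fun t =>
    (∀ x ∈ t, δ ≤ ‖F x‖) ∧ ∀ x ∈ t, ∀ y ∈ t, x ≠ y → 1 < dist x y
  have hcard : ∀ t, Sep t → t.card ≤ ⌊M.toReal⌋₊ := by
    intro t ht
    have hsub : (⋃ x ∈ t, Metric.ball x ρ) ⊆ {x | ENNReal.ofReal (δ / 2) ≤ ‖F x‖ₑ} := by
      refine Set.iUnion₂_subset fun x hx y hy => ?_
      rw [Set.mem_ofPred_eq, ← ofReal_norm]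
      refine ENNReal.ofReal_le_ofReal ?_
      have h1 := hFL x y
      have h2 : ‖x - y‖ ≤ ρ := by
        rw [← dist_eq_norm, dist_comm]
        exact (Metric.mem_ball.1 hy).le
      have h3 : L * ‖x - y‖ ≤ L * ρ := by gcongr
      have h4 := ht.1 x hx
      have h5 := norm_sub_norm_le (F x) (F y)
      linarith
    have hdisj : (t : Set (Space d)).PairwiseDisjoint fun x => Metric.ball x ρ := by
      intro x hx y hy hxy
      refine Metric.ball_disjoint_ball ?_
      linarith [ht.2 x hx y hy hxy]
    have hmeas : volume (⋃ x ∈ t, Metric.ball x ρ) = t.card * v := by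
      rw [measure_biUnion_finset hdisj fun x _ => measurableSet_ball]
      simp only [Measure.addHaar_ball_center, Finset.sum_const, nsmul_eq_mul, hv]
    have h1 := (mul_meas_ge_le_pow_eLpNorm' volume hs0 hs hFc.aestronglyMeasurable
      (ENNReal.ofReal (δ / 2))).trans (ENNReal.rpow_le_rpow hFC ENNReal.toReal_nonneg)
    have h2 : (t.card : ℝ≥0∞) ≤ M := by
      rw [hM, ENNReal.le_div_iff_mul_le (Or.inl hv0) (Or.inl measure_ball_lt_top.ne), ← hmeas,
        ENNReal.le_div_iff_mul_le (Or.inl hε0) (Or.inl hεt), mul_comm]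
      exact le_trans (by gcongr) h1
    rw [Nat.le_floor_iff ENNReal.toReal_nonneg]
    have := ENNReal.toReal_mono hMt h2
    simpa using this
  have hne : {n | ∃ t, Sep t ∧ t.card = n}.Nonempty := ⟨0, ∅, by simp [Sep], by simp⟩
  have hbdd : BddAbove {n | ∃ t, Sep t ∧ t.card = n} := ⟨⌊M.toReal⌋₊, by
    rintro _ ⟨t, ht, rfl⟩
    exact hcard t ht⟩
  obtain ⟨t, ht, htc⟩ := Nat.sSup_mem hne hbdd
  refine ⟨t, hcard t ht, fun x hx => ?_⟩
  by_contra! hfar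
  have hxt : x ∉ t := fun h => by linarith [hfar x h, dist_self x]
  have hins : Sep (insert x t) := by
    constructor
    · intro y hy
      rcases Finset.mem_insert.1 hy with rfl | hy
      · exact hx
      · exact ht.1 y hy
    · intro y hy z hz hyz
      rcases Finset.mem_insert.1 hy with hy1 | hy1 <;>
        rcases Finset.mem_insert.1 hz with hz1 | hz1
      · exact absurd (hy1.trans hz1.symm) hyz
      · rw [hy1]
        exact hfar z hz1
      · rw [hz1, dist_comm]
        exact hfar y hy1
      · exact ht.2 y hy1 z hz1 hyz
  have := le_csSup hbdd ⟨_, hins, rfl⟩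
  rw [Finset.card_insert_of_notMem hxt, ← htc] at this
  omega

theorem tendsto_cocompact_of_lipschitz {s : ℝ≥0∞} (hs0 : s ≠ 0) (hs : s ≠ ∞) {F : Space d → ℂ}
    {L : ℝ} (hL : 0 ≤ L) (hFc : Continuous F) (hFL : ∀ x y, ‖F x - F y‖ ≤ L * ‖x - y‖)
    (hF : eLpNorm F s volume ≠ ∞) : Tendsto F (cocompact (Space d)) (𝓝 0) := by
  rw [Metric.tendsto_nhds]
  intro δ hδ
  obtain ⟨N, hN⟩ := exists_card_cover (d := d) hs0 hs hF hL hδ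
  obtain ⟨t, -, ht⟩ := hN F hFc hFL le_rfl
  have hK : IsCompact (⋃ y ∈ t, Metric.closedBall y 1) :=
    t.isCompact_biUnion fun y _ => isCompact_closedBall y 1
  filter_upwards [hK.compl_mem_cocompact] with x hx
  by_contra! h
  rw [dist_zero_right] at h
  obtain ⟨y, hy, hxy⟩ := ht x h
  exact hx (Set.mem_biUnion hy (Metric.mem_closedBall.2 hxy))

variable [Fact (1 ≤ p)]

/-- The Riemann-Lebesgue lemma on the sphere, as a consequence of any extension estimate. -/
theorem tendsto_extend_cocompact {s : ℝ≥0∞} (hs0 : s ≠ 0) (hs : s ≠ ∞) (hS : opNorm d p s ≠ ∞)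
    (f : Lp ℂ p (surf d)) : Tendsto (extend f) (cocompact (Space d)) (𝓝 0) := by
  refine tendsto_cocompact_of_lipschitz hs0 hs (mul_nonneg embConst_nonneg (norm_nonneg f))
    (continuous_extend f) (norm_extend_Lp_sub_le f) ?_
  exact ((eLpNorm_extend_Lp_le f).trans_lt
    (ENNReal.mul_lt_top hS.lt_top enorm_lt_top)).ne

end Covering

/-! ### Almost orthogonality of diverging characters -/

section Orthogonality

variable {d : ℕ} {p : ℝ≥0∞} [Fact (1 ≤ p)] {ι J : Type*} {U : Filter ι}

/-- The sequences `x j` diverge from one another along `U`. -/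
def DivergeAlong (U : Filter ι) (x : J → ι → Space d) : Prop :=
  ∀ j k, j ≠ k → Tendsto (fun n => x j n - x k n) U (cocompact (Space d))

theorem tendsto_setIntegral_character {s : ℝ≥0∞} (hs0 : s ≠ 0) (hs : s ≠ ∞)
    (hS : opNorm d p s ≠ ∞) {A : Set (Sph d)} (hA : MeasurableSet A) :
    Tendsto (fun y : Space d => ∫ ω in A, character y ω ∂(surf d)) (cocompact (Space d))
      (𝓝 0) := by
  have hm : MemLp (A.indicator fun _ : Sph d => (1 : ℂ)) p (surf d) :=
    (memLp_const 1).indicator hA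
  refine (tendsto_extend_cocompact hs0 hs hS (hm.toLp _)).congr fun y => ?_
  rw [extend_congr_ae hm.coeFn_toLp, extend, ← integral_indicator hA]
  congr 1
  ext ω
  by_cases h : ω ∈ A <;> simp [h]

variable [Fintype J]

/-- Characters at frequencies diverging from one another are almost orthogonal on every fixed
measurable set. -/
theorem eventually_bessel {s : ℝ≥0∞} (hs0 : s ≠ 0) (hs : s ≠ ∞)
    (hS : opNorm d p s ≠ ∞) {A : Set (Sph d)} (hA : MeasurableSet A) {x : J → ι → Space d}
    (hx : DivergeAlong U x) {η : ℝ} (hη : 0 < η) :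
    ∀ᶠ n in U, ∀ c : J → ℂ,
      ∫ ω in A, ‖∑ j, c j * character (x j n) ω‖ ^ (2 : ℝ) ∂(surf d) ≤
        ((surf d).real A + η) * ∑ j, ‖c j‖ ^ (2 : ℝ) := by
  classical
  rcases isEmpty_or_nonempty J with hJ | hJ
  · refine Eventually.of_forall fun n c => ?_
    simp
  set N : ℝ := (Fintype.card J : ℝ) with hN
  have hN0 : 0 < N := by rw [hN]; exact_mod_cast Fintype.card_pos
  have hoff : ∀ᶠ n in U, ∀ j k, j ≠ k →
      ‖∫ ω in A, character (x j n - x k n) ω ∂(surf d)‖ ≤ η / N := by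
    refine eventually_all.2 fun j => eventually_all.2 fun k => ?_
    by_cases hjk : j = k
    · exact Eventually.of_forall fun n h => absurd hjk h
    have h1 := ((tendsto_setIntegral_character hs0 hs hS hA).comp (hx j k hjk)).norm
    rw [norm_zero] at h1
    filter_upwards [h1.eventually (gt_mem_nhds (by positivity : 0 < η / N))] with n hn _
    exact hn.le
  filter_upwards [hoff] with n hn c
  have hint : ∀ y : Space d, IntegrableOn (character y) A (surf d) := fun y =>
    Integrable.of_bound (continuous_character y).aestronglyMeasurable 1
      (Eventually.of_forall fun ω => (norm_character y ω).le)
  have hexp : ∀ ω, ((‖∑ j, c j * character (x j n) ω‖ ^ (2 : ℝ) : ℝ) : ℂ) =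
      ∑ j, ∑ k, c j * (starRingEnd ℂ) (c k) * character (x j n - x k n) ω := by
    intro ω
    have hconj : ∀ y z : Space d, character (y - z) ω =
        character y ω * (starRingEnd ℂ) (character z ω) := by
      intro y z
      have h1 : character z ω * (starRingEnd ℂ) (character z ω) = 1 := by
        rw [Complex.mul_conj, Complex.normSq_eq_norm_sq, norm_character]
        simp
      have h2 : character y ω = character (y - z) ω * character z ω := by
        rw [← character_add, sub_add_cancel]
      rw [h2, mul_assoc, h1, mul_one]
    rw [Real.rpow_two, ← Complex.normSq_eq_norm_sq, ← Complex.mul_conj, map_sum,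
      Finset.sum_mul_sum]
    refine Finset.sum_congr rfl fun j _ => Finset.sum_congr rfl fun k _ => ?_
    rw [hconj, map_mul]
    ring
  have hI : ((∫ ω in A, ‖∑ j, c j * character (x j n) ω‖ ^ (2 : ℝ) ∂(surf d) : ℝ) : ℂ) =
      ∑ j, ∑ k, c j * (starRingEnd ℂ) (c k) *
        ∫ ω in A, character (x j n - x k n) ω ∂(surf d) := by
    rw [← integral_complex_ofReal, integral_congr_ae (Eventually.of_forall hexp),
      integral_finsetSum _ fun j _ => integrable_finsetSum _ fun k _ => (hint _).const_mul _]
    refine Finset.sum_congr rfl fun j _ => ?_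
    rw [integral_finsetSum _ fun k _ => (hint _).const_mul _]
    refine Finset.sum_congr rfl fun k _ => ?_
    rw [integral_const_mul]
  have hI0 : 0 ≤ ∫ ω in A, ‖∑ j, c j * character (x j n) ω‖ ^ (2 : ℝ) ∂(surf d) :=
    integral_nonneg fun ω => by positivity
  have hI' := congrArg norm hI
  rw [Complex.norm_real, Real.norm_of_nonneg hI0] at hI'
  rw [hI']
  have hterm : ∀ j k, ‖c j * (starRingEnd ℂ) (c k) *
      ∫ ω in A, character (x j n - x k n) ω ∂(surf d)‖ ≤
      (if j = k then (surf d).real A * ‖c j‖ ^ (2 : ℝ) else 0) + η / N * (‖c j‖ * ‖c k‖) := by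
    intro j k
    rw [norm_mul, norm_mul, RCLike.norm_conj]
    split_ifs with h
    · subst h
      have h1 : ‖∫ ω in A, character (x j n - x j n) ω ∂(surf d)‖ = (surf d).real A := by
        simp [character]
      rw [h1, Real.rpow_two]
      have : 0 ≤ η / N * (‖c j‖ * ‖c j‖) := by positivity
      nlinarith
    · rw [zero_add, mul_comm]
      gcongr
      exact hn j k h
  calc _ ≤ ∑ j, ∑ k, ((if j = k then (surf d).real A * ‖c j‖ ^ (2 : ℝ) else 0) +
        η / N * (‖c j‖ * ‖c k‖)) := by
        refine (norm_sum_le _ _).trans (Finset.sum_le_sum fun j _ => ?_)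
        exact (norm_sum_le _ _).trans (Finset.sum_le_sum fun k _ => hterm j k)
    _ = (surf d).real A * ∑ j, ‖c j‖ ^ (2 : ℝ) + η / N * (∑ j, ‖c j‖) ^ 2 := by
        simp only [Finset.sum_add_distrib, Finset.sum_ite_eq, Finset.mem_univ, if_true]
        rw [← Finset.mul_sum, sq, Finset.sum_mul_sum]
        simp only [Finset.mul_sum]
    _ ≤ (surf d).real A * ∑ j, ‖c j‖ ^ (2 : ℝ) + η / N * (N * ∑ j, ‖c j‖ ^ (2 : ℝ)) := by
        gcongr
        have := sq_sum_le_card_mul_sum_sq (s := Finset.univ) (f := fun j => ‖c j‖)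
        simpa only [Real.rpow_two, Finset.card_univ] using this
    _ = _ := by field_simp

end Orthogonality

/-! ### Decoupling of diverging frequencies -/

section Decoupling

variable {d : ℕ} {ι J : Type*} {U : Filter ι} [Fintype J]

theorem integral_eq_sum_fiber {V : Type*} (Φ : SimpleFunc (Sph d) V) {h : Sph d → ℝ}
    (hh : ∀ v ∈ Φ.range, IntegrableOn h (Φ ⁻¹' {v}) (surf d)) :
    ∫ ω, h ω ∂(surf d) = ∑ v ∈ Φ.range, ∫ ω in Φ ⁻¹' {v}, h ω ∂(surf d) := by
  rw [← integral_biUnion_finset Φ.range (fun v _ => Φ.measurableSet_fiber v) _ hh]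
  · have : (⋃ v ∈ Φ.range, Φ ⁻¹' {v}) = Set.univ := by
      refine Set.eq_univ_of_forall fun ω => ?_
      exact Set.mem_biUnion (Φ.mem_range_self ω) rfl
    rw [this, setIntegral_univ]
  · intro v _ w _ hvw
    exact Disjoint.preimage _ (Set.disjoint_singleton.2 hvw)

/-- Decoupling of diverging frequencies, for coefficients taking finitely many values: the
Hausdorff-Young inequality on each set where the coefficients are constant. -/
theorem eventually_integral_simpleFunc_le {p s₀ : ℝ≥0∞} [Fact (1 ≤ p)] (hs0 : s₀ ≠ 0)
    (hs₀ : s₀ ≠ ∞) (hS : opNorm d p s₀ ≠ ∞) {x : J → ι → Space d} (hx : DivergeAlong U x) {s : ℝ}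
    (hs : 1 < s) (Φ : SimpleFunc (Sph d) (J → ℂ)) {η : ℝ} (hη : 0 < η) :
    ∀ᶠ n in U, ∫ ω, ‖∑ j, Φ ω j * character (x j n) ω‖ ^ s ∂(surf d) ≤
      ∫ ω, (∑ j, ‖Φ ω j‖ ^ min s (s / (s - 1))) ^ (s / min s (s / (s - 1))) ∂(surf d) + η := by
  set t := min s (s / (s - 1)) with ht
  have e0 : 0 < s - 1 := by linarith
  have ht0 : 0 < t := lt_min (by linarith) (div_pos (by linarith) e0)
  set g : (J → ℂ) → ℝ := fun v => (∑ j, ‖v j‖ ^ t) ^ (s / t) with hg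
  have hg0 : ∀ v, 0 ≤ g v := fun v =>
    Real.rpow_nonneg (Finset.sum_nonneg fun j _ => by positivity) _
  set T : ℝ := ∑ v ∈ Φ.range, g v with hT
  have hT0 : 0 ≤ T := Finset.sum_nonneg fun v _ => hg0 v
  set κ := η / (T + 1) with hκ
  have hκ0 : 0 < κ := by positivity
  have hbes : ∀ᶠ n in U, ∀ v ∈ Φ.range, ∀ c : J → ℂ,
      ∫ ω in Φ ⁻¹' {v}, ‖∑ j, c j * character (x j n) ω‖ ^ (2 : ℝ) ∂(surf d) ≤
        ((surf d).real (Φ ⁻¹' {v}) + κ) * ∑ j, ‖c j‖ ^ (2 : ℝ) :=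
    (Finset.eventually_all Φ.range).2 fun v _ =>
      eventually_bessel hs0 hs₀ hS (Φ.measurableSet_fiber v) hx hκ0
  filter_upwards [hbes] with n hn
  have hu : ∀ (v : J → ℂ) (j : J), AEStronglyMeasurable (character (x j n))
      ((surf d).restrict (Φ ⁻¹' {v})) := fun v j =>
    (continuous_character _).aestronglyMeasurable
  have heq : ∀ v, ∀ᵐ ω ∂((surf d).restrict (Φ ⁻¹' {v})),
      ‖∑ j, v j * character (x j n) ω‖ ^ s = ‖∑ j, Φ ω j * character (x j n) ω‖ ^ s := fun v =>
    (ae_restrict_iff' (Φ.measurableSet_fiber v)).2 (Eventually.of_forall fun ω hω => by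
      have : Φ ω = v := hω
      rw [this])
  have hgeq : ∀ v, ∀ᵐ ω ∂((surf d).restrict (Φ ⁻¹' {v})), g v = g (Φ ω) := fun v =>
    (ae_restrict_iff' (Φ.measurableSet_fiber v)).2 (Eventually.of_forall fun ω hω => by
      have : Φ ω = v := hω
      rw [this])
  rw [integral_eq_sum_fiber Φ fun v _ => (integrable_norm_sum_mul_rpow (hu v)
      (fun j ω => norm_character (x j n) ω) v (by linarith : 0 ≤ s)).congr (heq v),
    integral_eq_sum_fiber Φ (h := fun ω => g (Φ ω)) fun v _ =>
      (integrable_const (g v)).congr (hgeq v)]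
  have hcell : ∀ v ∈ Φ.range, ∫ ω in Φ ⁻¹' {v}, ‖∑ j, Φ ω j * character (x j n) ω‖ ^ s ∂(surf d) ≤
      ∫ ω in Φ ⁻¹' {v}, g (Φ ω) ∂(surf d) + κ * g v := by
    intro v hv
    rw [← integral_congr_ae (heq v), ← integral_congr_ae (hgeq v), integral_const, smul_eq_mul,
      ← add_mul, measureReal_restrict_apply_univ]
    have hpos : 0 < (surf d).real (Φ ⁻¹' {v}) + κ := add_pos_of_nonneg_of_pos measureReal_nonneg hκ0
    refine integral_norm_sum_mul_rpow_le (hu v) (fun j ω => norm_character (x j n) ω) hpos ?_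
      (hn v hv) hs v
    rw [measureReal_restrict_apply_univ]
    linarith
  refine (Finset.sum_le_sum hcell).trans ?_
  rw [Finset.sum_add_distrib, ← Finset.mul_sum, ← hT]
  have : κ * T ≤ η := by
    rw [hκ, div_mul_eq_mul_div, div_le_iff₀ (by positivity)]
    nlinarith
  linarith

theorem coeFn_finsetSum {K G : Type*} [NormedAddCommGroup G] {r : ℝ≥0∞} (s : Finset K)
    (g : K → Lp G r (surf d)) :
    ((∑ j ∈ s, g j : Lp G r (surf d)) : Sph d → G) =ᵐ[surf d] fun ω => ∑ j ∈ s, g j ω := by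
  classical
  induction s using Finset.induction_on with
  | empty =>
    simp only [Finset.sum_empty]
    exact Lp.coeFn_zero _ _ _
  | insert j s hj ih =>
    rw [Finset.sum_insert hj]
    filter_upwards [Lp.coeFn_add (g j) (∑ j ∈ s, g j), ih] with ω h1 h2
    rw [h1, Pi.add_apply, h2, Finset.sum_insert hj]

variable {r : ℝ≥0∞}

theorem one_lt_toReal (hr1 : 1 < r) (hr : r ≠ ∞) : 1 < r.toReal := by
  rw [← ENNReal.toReal_one]
  exact (ENNReal.toReal_lt_toReal ENNReal.one_ne_top hr).2 hr1

variable [Fact (1 ≤ r)]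

/-- Minkowski's inequality in `L^(r / t)`. -/
theorem integral_sum_rpow_le (hr : r ≠ ∞) (ψ : J → Lp ℂ r (surf d)) {t : ℝ} (ht0 : 0 < t)
    (ht : t ≤ r.toReal) :
    ∫ ω, (∑ j, ‖ψ j ω‖ ^ t) ^ (r.toReal / t) ∂(surf d) ≤
      (∑ j, ‖ψ j‖ ^ t) ^ (r.toReal / t) := by
  set q : ℝ≥0∞ := ENNReal.ofReal t with hq
  have hq0 : q ≠ 0 := by simpa [hq] using ht0
  have hqt : q.toReal = t := ENNReal.toReal_ofReal ht0.le
  have hrq : (r / q).toReal = r.toReal / t := by rw [ENNReal.toReal_div, hqt]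
  have hrt : r / q ≠ ∞ := ENNReal.div_ne_top hr hq0
  have : Fact (1 ≤ r / q) := ⟨by
    rw [ENNReal.le_div_iff_mul_le (Or.inl hq0) (Or.inl ENNReal.ofReal_ne_top), one_mul]
    exact ENNReal.ofReal_le_of_le_toReal ht⟩
  have hm : ∀ j, MemLp (fun ω => ‖ψ j ω‖ ^ t) (r / q) (surf d) := fun j => by
    simpa only [hqt] using (Lp.memLp (ψ j)).norm_rpow_div q
  have hr0 : 0 < r.toReal := lt_of_lt_of_le ht0 ht
  set g : J → Lp ℝ (r / q) (surf d) := fun j => (hm j).toLp _ with hg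
  have hgn : ∀ j, ‖g j‖ = ‖ψ j‖ ^ t := by
    intro j
    have h1 := norm_rpow_eq_integral hrt (g j)
    have h2 : ∫ ω, ‖g j ω‖ ^ (r / q).toReal ∂(surf d) = ‖ψ j‖ ^ r.toReal := by
      rw [norm_rpow_eq_integral hr]
      refine integral_congr_ae ?_
      filter_upwards [(hm j).coeFn_toLp] with ω hω
      rw [hg, hω, Real.norm_of_nonneg (by positivity), ← Real.rpow_mul (norm_nonneg _), hrq]
      congr 1
      field_simp
    have h3 : ‖ψ j‖ ^ r.toReal = (‖ψ j‖ ^ t) ^ (r.toReal / t) := by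
      rw [← Real.rpow_mul (norm_nonneg _)]
      congr 1
      field_simp
    rw [h2, hrq, h3] at h1
    exact (Real.rpow_left_inj (norm_nonneg _) (by positivity) (by positivity)).1 h1
  have h4 := norm_rpow_eq_integral hrt (∑ j, g j)
  have h5 : ∫ ω, ‖(∑ j, g j : Lp ℝ (r / q) (surf d)) ω‖ ^ (r / q).toReal ∂(surf d) =
      ∫ ω, (∑ j, ‖ψ j ω‖ ^ t) ^ (r.toReal / t) ∂(surf d) := by
    refine integral_congr_ae ?_
    have hall : ∀ᵐ ω ∂(surf d), ∀ j, g j ω = ‖ψ j ω‖ ^ t :=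
      ae_all_iff.2 fun j => (hm j).coeFn_toLp
    filter_upwards [hall, coeFn_finsetSum Finset.univ g] with ω h6 h7
    rw [h7, Finset.sum_congr rfl fun j _ => h6 j, hrq,
      Real.norm_of_nonneg (Finset.sum_nonneg fun j _ => by positivity)]
  rw [h5, hrq] at h4
  rw [← h4]
  refine Real.rpow_le_rpow (norm_nonneg _) ((norm_sum_le _ _).trans_eq ?_) (by positivity)
  exact Finset.sum_congr rfl fun j _ => hgn j

theorem modulate_sub {p : ℝ≥0∞} [Fact (1 ≤ p)] (x : Space d) (f g : Lp ℂ p (surf d)) :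
    modulate x (f - g) = modulate x f - modulate x g := map_sub (modulateL x) f g

/-- Decoupling of diverging frequencies: asymptotically, the norm of `∑ e^{i x_j·ω} ψ_j` is
bounded by an `ℓ^t` sum of the norms, `t = min(r, r')`, with constant `1`. The extension estimate
for `p` and `s₀`, which need not be related to `r`, only serves the Riemann-Lebesgue lemma. -/
theorem eventually_norm_sum_modulate_le {p s₀ : ℝ≥0∞} [Fact (1 ≤ p)] (hs0 : s₀ ≠ 0)
    (hs₀ : s₀ ≠ ∞) (hS : opNorm d p s₀ ≠ ∞) {x : J → ι → Space d} (hx : DivergeAlong U x)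
    (hr1 : 1 < r) (hr : r ≠ ∞) (ψ : J → Lp ℂ r (surf d)) {t : ℝ}
    (ht : t = min r.toReal (r.toReal / (r.toReal - 1))) {ε : ℝ} (hε : 0 < ε) :
    ∀ᶠ n in U, ‖∑ j, modulate (x j n) (ψ j)‖ ≤ (∑ j, ‖ψ j‖ ^ t) ^ (1 / t) + ε := by
  have hs := one_lt_toReal hr1 hr
  set s := r.toReal with hsdef
  have e0 : 0 < s - 1 := by linarith
  have ht0 : 0 < t := by
    rw [ht]
    exact lt_min (by linarith) (div_pos (by linarith) e0)
  have hts : t ≤ s := by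
    rw [ht]
    exact min_le_left _ _
  -- approximation by simple functions
  have hlim : Tendsto (fun κ : ℝ => (∑ j, (‖ψ j‖ + κ) ^ t) ^ (1 / t) + Fintype.card J * κ)
      (𝓝[>] 0) (𝓝 ((∑ j, (‖ψ j‖ + 0) ^ t) ^ (1 / t) + Fintype.card J * 0)) := by
    have : Continuous fun κ : ℝ =>
        (∑ j, (‖ψ j‖ + κ) ^ t) ^ (1 / t) + (Fintype.card J : ℝ) * κ := by
      refine Continuous.add (Continuous.rpow_const ?_ fun _ => Or.inr (by positivity))
        (continuous_const.mul continuous_id)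
      refine continuous_finsetSum _ fun j _ => ?_
      exact (continuous_const.add continuous_id).rpow_const fun _ => Or.inr ht0.le
    exact (this.tendsto 0).mono_left nhdsWithin_le_nhds
  simp only [add_zero, mul_zero] at hlim
  obtain ⟨κ, hκ, hκ0⟩ := ((hlim.eventually (gt_mem_nhds
    (by linarith : (∑ j, ‖ψ j‖ ^ t) ^ (1 / t) < (∑ j, ‖ψ j‖ ^ t) ^ (1 / t) + ε / 2))).and
    self_mem_nhdsWithin).exists
  replace hκ0 : 0 < κ := hκ0
  choose Ψ hΨ hΨm using fun j => (Lp.memLp (ψ j)).exists_simpleFunc_eLpNorm_sub_lt hr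
    (ε := ENNReal.ofReal κ) (by simpa using hκ0)
  set ψ' : J → Lp ℂ r (surf d) := fun j => (hΨm j).toLp (Ψ j) with hψ'
  have hψ'c : ∀ j, ψ' j =ᵐ[surf d] Ψ j := fun j => (hΨm j).coeFn_toLp
  have hclose : ∀ j, ‖ψ j - ψ' j‖ ≤ κ := by
    intro j
    rw [Lp.norm_def]
    refine ENNReal.toReal_le_of_le_ofReal hκ0.le (le_trans (le_of_eq ?_) (hΨ j).le)
    refine eLpNorm_congr_ae ?_
    filter_upwards [Lp.coeFn_sub (ψ j) (ψ' j), hψ'c j] with ω h1 h2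
    rw [h1, Pi.sub_apply, Pi.sub_apply, h2]
  let Φ : SimpleFunc (Sph d) (J → ℂ) :=
    { toFun := fun ω j => Ψ j ω
      measurableSet_fiber' := fun v =>
        (measurable_pi_iff.2 fun j => (Ψ j).measurable) (measurableSet_singleton v)
      finite_range' := (Set.Finite.pi' fun j => (Ψ j).finite_range).subset (by
        rintro _ ⟨ω, rfl⟩ j
        exact ⟨ω, rfl⟩) }
  have hΦ : ∀ ω j, Φ ω j = Ψ j ω := fun ω j => rfl
  set Y := (∑ j, ‖ψ' j‖ ^ t) ^ (1 / t) with hY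
  have hY0 : 0 ≤ Y := Real.rpow_nonneg (Finset.sum_nonneg fun j _ => by positivity) _
  have hη : 0 < (Y + ε / 2) ^ s - Y ^ s :=
    sub_pos.2 (Real.rpow_lt_rpow hY0 (by linarith) (by linarith))
  have hYle : Y ≤ (∑ j, (‖ψ j‖ + κ) ^ t) ^ (1 / t) := by
    refine Real.rpow_le_rpow (Finset.sum_nonneg fun j _ => by positivity)
      (Finset.sum_le_sum fun j _ => ?_) (by positivity)
    refine Real.rpow_le_rpow (norm_nonneg _) ?_ ht0.le
    have := norm_sub_norm_le (ψ' j) (ψ j)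
    rw [norm_sub_rev] at this
    linarith [hclose j]
  filter_upwards [eventually_integral_simpleFunc_le hs0 hs₀ hS hx hs Φ hη] with n hn
  have hsimple : ‖∑ j, modulate (x j n) (ψ' j)‖ ≤ Y + ε / 2 := by
    rw [← Real.rpow_le_rpow_iff (norm_nonneg _) (by linarith) (by linarith : 0 < s), hsdef,
      norm_rpow_eq_integral hr, ← hsdef]
    have h1 : ∫ ω, ‖(∑ j, modulate (x j n) (ψ' j) : Lp ℂ r (surf d)) ω‖ ^ s ∂(surf d) =
        ∫ ω, ‖∑ j, Φ ω j * character (x j n) ω‖ ^ s ∂(surf d) := by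
      refine integral_congr_ae ?_
      have hall : ∀ᵐ ω ∂(surf d), ∀ j,
          modulate (x j n) (ψ' j) ω = Φ ω j * character (x j n) ω := by
        refine ae_all_iff.2 fun j => ?_
        filter_upwards [coeFn_modulate (x j n) (ψ' j), hψ'c j] with ω h1 h2
        rw [h1, h2, hΦ, mul_comm]
      filter_upwards [hall, coeFn_finsetSum Finset.univ fun j => modulate (x j n) (ψ' j)]
        with ω h2 h3
      rw [h3, Finset.sum_congr rfl fun j _ => h2 j]
    have h2 : ∫ ω, (∑ j, ‖Φ ω j‖ ^ t) ^ (s / t) ∂(surf d) ≤ Y ^ s := by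
      have h3 := integral_sum_rpow_le hr ψ' ht0 hts
      have h4 : ∫ ω, (∑ j, ‖ψ' j ω‖ ^ t) ^ (r.toReal / t) ∂(surf d) =
          ∫ ω, (∑ j, ‖Φ ω j‖ ^ t) ^ (s / t) ∂(surf d) := by
        refine integral_congr_ae ?_
        have hall : ∀ᵐ ω ∂(surf d), ∀ j, ψ' j ω = Ψ j ω := ae_all_iff.2 hψ'c
        filter_upwards [hall] with ω h5
        simp only [h5, hΦ, hsdef]
      rw [h4] at h3
      refine h3.trans_eq ?_
      rw [hY, ← Real.rpow_mul (Finset.sum_nonneg fun j _ => by positivity)]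
      congr 1
      rw [one_div_mul_eq_div]
    rw [h1]
    rw [← ht] at hn
    linarith
  have hdiff : ‖∑ j, modulate (x j n) (ψ j) - ∑ j, modulate (x j n) (ψ' j)‖ ≤
      Fintype.card J * κ := by
    rw [← Finset.sum_sub_distrib]
    refine (norm_sum_le _ _).trans ?_
    calc _ ≤ ∑ _j : J, κ := Finset.sum_le_sum fun j _ => by
          rw [← modulate_sub, norm_modulate]
          exact hclose j
      _ = _ := by simp
  have := norm_sub_norm_le (∑ j, modulate (x j n) (ψ j)) (∑ j, modulate (x j n) (ψ' j))
  linarith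

end Decoupling

/-! ### The `ℓ^τ` bound for profiles -/

section Profiles

variable {d : ℕ} {ι J : Type*} {U : Filter ι} {p : ℝ≥0∞}

instance : Fact (1 ≤ p.conjExponent) := ⟨by rw [ENNReal.conjExponent]; exact le_self_add⟩

theorem conjExponent_ne_top (hp1 : 1 < p) : p.conjExponent ≠ ∞ := by
  rw [ENNReal.conjExponent]
  exact ENNReal.add_ne_top.2 ⟨ENNReal.one_ne_top, ENNReal.inv_ne_top.2 (tsub_pos_of_lt hp1).ne'⟩

theorem one_lt_conjExponent (hp : p ≠ ∞) : 1 < p.conjExponent := by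
  rw [ENNReal.conjExponent]
  exact ENNReal.lt_add_right ENNReal.one_ne_top
    (ENNReal.inv_ne_zero.2 (ENNReal.sub_ne_top hp))

theorem toReal_conjExponent (hp1 : 1 < p) (hp : p ≠ ∞) :
    p.conjExponent.toReal = p.toReal / (p.toReal - 1) := by
  have hP := one_lt_toReal hp1 hp
  rw [ENNReal.conjExponent, ENNReal.toReal_add ENNReal.one_ne_top
    (ENNReal.inv_ne_top.2 (tsub_pos_of_lt hp1).ne'), ENNReal.toReal_inv,
    ENNReal.toReal_sub_of_le hp1.le hp, ENNReal.toReal_one]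
  have : p.toReal - 1 ≠ 0 := by linarith
  field_simp
  ring

variable [Fact (1 ≤ p)]

variable (d p) in
/-- The pairing `(f, g) ↦ ∫ f g dσ` between `L^p(S^d)` and `L^{p'}(S^d)`. -/
def pairing : Lp ℂ p (surf d) →L[ℂ] Lp ℂ p.conjExponent (surf d) →L[ℂ] ℂ :=
  (ContinuousLinearMap.mul ℂ ℂ).lpPairing (surf d) p p.conjExponent

theorem pairing_apply (f : Lp ℂ p (surf d)) (g : Lp ℂ p.conjExponent (surf d)) :
    pairing d p f g = ∫ ω, f ω * g ω ∂(surf d) :=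
  (ContinuousLinearMap.mul ℂ ℂ).lpPairing_eq_integral f g

theorem norm_pairing_le (f : Lp ℂ p (surf d)) (g : Lp ℂ p.conjExponent (surf d)) :
    ‖pairing d p f g‖ ≤ ‖f‖ * ‖g‖ := by
  have h1 : pairing d p f g =
      ∫ ω, (ContinuousLinearMap.mul ℂ ℂ).holder (p := p) (q := p.conjExponent) 1 f g ω
        ∂(surf d) := by
    rw [pairing_apply]
    refine integral_congr_ae ?_
    filter_upwards [(ContinuousLinearMap.mul ℂ ℂ).coeFn_holder (r := 1) f g] with ω h
    rw [h, ContinuousLinearMap.mul_apply']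
  rw [h1, ← L1.integral_eq_integral]
  refine (L1.norm_integral_le _).trans ?_
  refine ((ContinuousLinearMap.mul ℂ ℂ).norm_holder_apply_apply_le f g).trans ?_
  have := ContinuousLinearMap.opNorm_mul_le (𝕜 := ℂ) (R := ℂ)
  calc _ ≤ 1 * ‖f‖ * ‖g‖ := by gcongr
    _ = _ := by rw [one_mul]

theorem pairing_modulate (x : Space d) (f : Lp ℂ p (surf d))
    (g : Lp ℂ p.conjExponent (surf d)) :
    pairing d p f (modulate x g) = pairing d p (modulate x f) g := by
  rw [pairing_apply, pairing_apply]
  refine integral_congr_ae ?_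
  filter_upwards [coeFn_modulate x f, coeFn_modulate x g] with ω h1 h2
  rw [h1, h2]
  ring

/-- The element `|φ| ^ (p - 2) conj φ` of the dual space. -/
theorem exists_norming (hp1 : 1 < p) (hp : p ≠ ∞) (φ : Lp ℂ p (surf d)) :
    ∃ ψ : Lp ℂ p.conjExponent (surf d), ‖ψ‖ = ‖φ‖ ^ (p.toReal - 1) ∧
      pairing d p φ ψ = ((‖φ‖ ^ p.toReal : ℝ) : ℂ) := by
  have hP := one_lt_toReal hp1 hp
  have hr := conjExponent_ne_top hp1
  have hrR := toReal_conjExponent hp1 hp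
  set P := p.toReal with hPdef
  have e0 : 0 < P - 1 := by linarith
  set h : Sph d → ℂ := fun ω => (starRingEnd ℂ) (φ ω) * ((‖φ ω‖ ^ (P - 2) : ℝ) : ℂ) with hh
  have hn : ∀ ω, ‖h ω‖ = ‖φ ω‖ ^ (P - 1) := by
    intro ω
    rw [hh, norm_mul, RCLike.norm_conj, Complex.norm_real, Real.norm_of_nonneg (by positivity)]
    rcases (norm_nonneg (φ ω)).eq_or_lt with h0 | h0
    · rw [← h0, zero_mul, Real.zero_rpow e0.ne']
    · rw [mul_comm, ← Real.rpow_add_one h0.ne']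
      congr 1
      ring
  have hφm : AEStronglyMeasurable φ (surf d) := Lp.aestronglyMeasurable φ
  have hm : AEStronglyMeasurable h (surf d) := by
    refine (Complex.continuous_conj.comp_aestronglyMeasurable hφm).mul ?_
    exact Complex.continuous_ofReal.comp_aestronglyMeasurable
      (hφm.norm.aemeasurable.pow_const (P - 2)).aestronglyMeasurable
  have hmem : MemLp h p.conjExponent (surf d) := by
    have h1 := (Lp.memLp φ).norm_rpow_div (ENNReal.ofReal (P - 1))
    rw [ENNReal.toReal_ofReal e0.le] at h1
    have h2 : p / ENNReal.ofReal (P - 1) = p.conjExponent := by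
      have hq0 : ENNReal.ofReal (P - 1) ≠ 0 := by simpa using hP
      rw [← ENNReal.toReal_eq_toReal_iff' (ENNReal.div_ne_top hp hq0) hr, ENNReal.toReal_div,
        ENNReal.toReal_ofReal e0.le, hrR]
    rw [h2] at h1
    exact h1.of_le hm (Eventually.of_forall fun ω => by
      rw [hn, Real.norm_of_nonneg (by positivity)])
  refine ⟨hmem.toLp h, ?_, ?_⟩
  · have h1 := norm_rpow_eq_integral hr (hmem.toLp h)
    have h2 : ∫ ω, ‖hmem.toLp h ω‖ ^ p.conjExponent.toReal ∂(surf d) = ‖φ‖ ^ P := by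
      rw [norm_rpow_eq_integral hp]
      refine integral_congr_ae ?_
      filter_upwards [hmem.coeFn_toLp] with ω hω
      rw [hω, hn, ← Real.rpow_mul (norm_nonneg _), hrR, ← hPdef]
      congr 1
      field_simp
    have h3 : ‖φ‖ ^ P = (‖φ‖ ^ (P - 1)) ^ (P / (P - 1)) := by
      rw [← Real.rpow_mul (norm_nonneg _)]
      congr 1
      field_simp
    rw [h2, h3, hrR] at h1
    exact (Real.rpow_left_inj (norm_nonneg _) (by positivity) (by positivity)).1 h1
  · rw [pairing_apply, norm_rpow_eq_integral hp, ← integral_complex_ofReal]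
    refine integral_congr_ae ?_
    filter_upwards [hmem.coeFn_toLp] with ω hω
    rw [hω, hh, ← mul_assoc, Complex.mul_conj, Complex.normSq_eq_norm_sq, ← Complex.ofReal_mul,
      ← hPdef]
    congr 1
    rcases (norm_nonneg (φ ω)).eq_or_lt with h0 | h0
    · rw [← h0, Real.zero_rpow (by linarith : P ≠ 0)]
      simp
    · rw [← Real.rpow_two, ← Real.rpow_add h0]
      congr 1
      ring

/-- The profiles of a bounded sequence satisfy `∑ ‖φ_j‖ ^ τ ≤ 1` with `τ = max(p, p')`: test the
sequence against the sum of suitable multiples of the elements that norm the profiles. -/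
theorem sum_norm_rpow_le_one [Fintype J] [U.NeBot] {s₀ : ℝ≥0∞} (hs0 : s₀ ≠ 0)
    (hs₀ : s₀ ≠ ∞) (hS : opNorm d p s₀ ≠ ∞) (hp1 : 1 < p) (hp : p ≠ ∞) {x : J → ι → Space d}
    (hx : DivergeAlong U x) {f : ι → Lp ℂ p (surf d)} (hf : ∀ n, ‖f n‖ ≤ 1)
    {φ : J → Lp ℂ p (surf d)} (hφ : ∀ j, WeakTendsto (fun n => modulate (x j n) (f n)) U (φ j))
    {τ : ℝ} (hτ : τ = max p.toReal p.conjExponent.toReal) :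
    ∑ j, ‖φ j‖ ^ τ ≤ 1 := by
  have hP := one_lt_toReal hp1 hp
  have hr := conjExponent_ne_top hp1
  have hr1 := one_lt_conjExponent hp
  have hrR := toReal_conjExponent hp1 hp
  set P := p.toReal with hPdef
  have e0 : 0 < P - 1 := by linarith
  set R := p.conjExponent.toReal with hR
  have hR1 : 1 < R := one_lt_toReal hr1 hr
  have hRP : R / (R - 1) = P := by
    have : R - 1 = 1 / (P - 1) := by rw [hrR]; field_simp; ring
    rw [this, hrR]
    field_simp
  obtain ⟨t, ht⟩ : ∃ t, t = min R (R / (R - 1)) := ⟨_, rfl⟩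
  -- `t` and `τ` are dual exponents
  have hτ1 : 1 < τ := by rw [hτ]; exact lt_max_of_lt_left hP
  have hPτ : P ≤ τ := by rw [hτ]; exact le_max_left _ _
  have htt : (τ - 1) * t = τ := by
    rw [ht, hRP, hτ]
    rcases le_total P R with h | h
    · rw [max_eq_right h, min_eq_right h, hrR]
      field_simp
      ring
    · rw [max_eq_left h, min_eq_left h, hrR]
      field_simp
  have ht1 : 1 < t := by
    rw [ht, hRP]
    exact lt_min hR1 hP
  choose ψ₀ hψ₀n hψ₀ using fun j => exists_norming hp1 hp (φ j)
  set ψ : J → Lp ℂ p.conjExponent (surf d) := fun j =>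
    ((‖φ j‖ ^ (τ - P) : ℝ) : ℂ) • ψ₀ j with hψ
  have hψn : ∀ j, ‖ψ j‖ ^ t = ‖φ j‖ ^ τ := by
    intro j
    rw [hψ, norm_smul, Complex.norm_real, Real.norm_of_nonneg (by positivity), hψ₀n]
    rcases (norm_nonneg (φ j)).eq_or_lt with h0 | h0
    · rw [← h0, Real.zero_rpow e0.ne', mul_zero, Real.zero_rpow (by linarith),
        Real.zero_rpow (by linarith)]
    · rw [← Real.rpow_add h0, ← Real.rpow_mul h0.le, ← hPdef]
      rw [show τ - P + (P - 1) = τ - 1 by ring, htt]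
  have hψp : ∀ j, pairing d p (φ j) (ψ j) = ((‖φ j‖ ^ τ : ℝ) : ℂ) := by
    intro j
    rw [hψ, map_smul, hψ₀, smul_eq_mul, ← Complex.ofReal_mul]
    congr 1
    rcases (norm_nonneg (φ j)).eq_or_lt with h0 | h0
    · rw [← h0, Real.zero_rpow (by linarith : p.toReal ≠ 0), mul_zero,
        Real.zero_rpow (by linarith)]
    · rw [← Real.rpow_add h0, ← hPdef]
      congr 1
      ring
  set X := ∑ j, ‖φ j‖ ^ τ with hX
  have hX0 : 0 ≤ X := Finset.sum_nonneg fun j _ => by positivity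
  have hlim : Tendsto (fun n => ‖pairing d p (f n) (∑ j, modulate (x j n) (ψ j))‖) U (𝓝 X) := by
    have h1 : Tendsto (fun n => ∑ j, pairing d p (modulate (x j n) (f n)) (ψ j)) U
        (𝓝 (∑ j, pairing d p (φ j) (ψ j))) :=
      tendsto_finsetSum _ fun j _ => hφ j ((pairing d p).flip (ψ j))
    have h2 := h1.norm
    have h3 : ‖∑ j, pairing d p (φ j) (ψ j)‖ = X := by
      rw [Finset.sum_congr rfl fun j _ => hψp j, ← Complex.ofReal_sum, Complex.norm_real,
        Real.norm_of_nonneg hX0]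
    rw [h3] at h2
    refine h2.congr fun n => ?_
    rw [map_sum]
    simp only [pairing_modulate]
  have hle : ∀ ε > 0, X ≤ X ^ (1 / t) + ε := by
    intro ε hε
    refine le_of_tendsto hlim ?_
    filter_upwards [eventually_norm_sum_modulate_le hs0 hs₀ hS hx hr1 hr ψ ht hε] with n hn
    calc _ ≤ ‖f n‖ * ‖∑ j, modulate (x j n) (ψ j)‖ := norm_pairing_le _ _
      _ ≤ 1 * ((∑ j, ‖ψ j‖ ^ t) ^ (1 / t) + ε) := by gcongr; exact hf n
      _ = _ := by rw [one_mul, Finset.sum_congr rfl fun j _ => hψn j]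
  have hle' : X ≤ X ^ (1 / t) := le_of_forall_pos_le_add hle
  by_contra! h
  have h1 : X ^ (1 / t) < X ^ (1 : ℝ) :=
    Real.rpow_lt_rpow_of_exponent_lt h (by rw [div_lt_one (by linarith)]; exact ht1)
  rw [Real.rpow_one] at h1
  linarith

end Profiles

/-! ### The range of exponents -/

section Exponents

variable {d : ℕ} {p q : ℝ≥0∞}

/-- The endpoint exponent `2 (d + 1) / d` is at most `max p ((d + 2) / d p')`: the two are equal
where the scaling line meets the diagonal. So the second alternative of the conjecture is void in
the range of the theorem. -/
theorem endpoint_le_max (hd : 1 ≤ d) (hp1 : 1 < p) (hp : p ≠ ∞) :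
    2 * ((d : ℝ≥0∞) + 1) / d ≤ max p (scalingExponent d p) := by
  have hP := one_lt_toReal hp1 hp
  have hD : (1 : ℝ) ≤ d := by exact_mod_cast hd
  have hd0 : (d : ℝ≥0∞) ≠ 0 := by exact_mod_cast (by omega : d ≠ 0)
  have hfin : 2 * ((d : ℝ≥0∞) + 1) / d ≠ ∞ := by
    refine ENNReal.div_ne_top ?_ hd0
    finiteness
  have hcoef : ((d : ℝ≥0∞) + 2) / d ≠ ∞ := by
    refine ENNReal.div_ne_top ?_ hd0
    finiteness
  have hsc : scalingExponent d p ≠ ∞ := ENNReal.mul_ne_top hcoef (conjExponent_ne_top hp1)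
  have e1 : (2 * ((d : ℝ≥0∞) + 1) / d).toReal = 2 * ((d : ℝ) + 1) / d := by
    rw [ENNReal.toReal_div, ENNReal.toReal_mul, ENNReal.toReal_add (by finiteness) (by finiteness)]
    simp
  have e2 : (scalingExponent d p).toReal = ((d : ℝ) + 2) / d * (p.toReal / (p.toReal - 1)) := by
    rw [scalingExponent, ENNReal.toReal_mul, toReal_conjExponent hp1 hp, ENNReal.toReal_div,
      ENNReal.toReal_add (by finiteness) (by finiteness)]
    simp
  rw [le_max_iff, ← ENNReal.toReal_le_toReal hfin hp, ← ENNReal.toReal_le_toReal hfin hsc, e1, e2]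
  rcases le_or_gt (2 * ((d : ℝ) + 1) / d) p.toReal with h | h
  · exact Or.inl h
  · right
    rw [lt_div_iff₀ (by linarith)] at h
    have h0 : 0 < p.toReal - 1 := by linarith
    rw [div_mul_div_comm, div_le_div_iff₀ (by linarith) (by positivity)]
    nlinarith

theorem one_lt_of_scalingExponent_lt [Fact (1 ≤ p)]
    (h : scalingExponent d p < q) : 1 < p := by
  refine lt_of_le_of_ne Fact.out fun h1 => ?_
  have h0 : ((d : ℝ≥0∞) + 2) / d ≠ 0 := by
    refine (ENNReal.div_pos ?_ (ENNReal.natCast_ne_top d)).ne'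
    simp
  rw [scalingExponent, ← h1, ENNReal.conjExponent, tsub_self, ENNReal.inv_zero, add_top,
    ENNReal.mul_top h0] at h
  exact not_top_lt h

theorem conjExponent_le_scalingExponent (hd : 1 ≤ d) : p.conjExponent ≤ scalingExponent d p := by
  have hd0 : (d : ℝ≥0∞) ≠ 0 := by exact_mod_cast (by omega : d ≠ 0)
  have : 1 ≤ ((d : ℝ≥0∞) + 2) / d := by
    rw [ENNReal.le_div_iff_mul_le (Or.inl hd0) (Or.inl (ENNReal.natCast_ne_top d)), one_mul]
    exact le_self_add
  calc p.conjExponent = 1 * p.conjExponent := (one_mul _).symm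
    _ ≤ _ := by rw [scalingExponent]; gcongr

/-- What the extension conjecture near `(p, q)` is used for: bounds at `(p, q)` and at some
`(p, s)` with `s < q`. -/
theorem exists_opNorm_ne_top (hd : 1 ≤ d) [Fact (1 ≤ p)] (hp1 : 1 < p) (hp : p ≠ ∞)
    (hpq : max p (scalingExponent d p) < q) (hconj : ExtensionConjectureNear d p q) :
    opNorm d p q ≠ ∞ ∧ ∃ s, s ≠ 0 ∧ s < q ∧ opNorm d p s ≠ ∞ := by
  have hmax := endpoint_le_max hd hp1 hp
  have hbdd : ∀ s, max p (scalingExponent d p) < s → ExtensionConjectureAt d p s →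
      opNorm d p s ≠ ∞ := by
    rintro s hs (h | h | h)
    · exact h.ne
    · exact absurd (h.trans hmax) (not_le.2 hs)
    · exact absurd (h.trans_le (le_max_right _ _)) (not_lt.2 hs.le)
  have hmem : ∀ s, max p (scalingExponent d p) < s →
      (p, s) ∈ Set.Icc (1 : ℝ≥0∞) ∞ ×ˢ Set.Icc (1 : ℝ≥0∞) ∞ := fun s hs =>
    ⟨⟨hp1.le, le_top⟩, ⟨hp1.le.trans ((le_max_left _ _).trans hs.le), le_top⟩⟩
  refine ⟨hbdd q hpq (hconj.self_of_nhdsWithin (hmem q hpq)), ?_⟩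
  have hIoo : ∀ᶠ s in 𝓝[<] q, s ∈ Set.Ioo (max p (scalingExponent d p)) q := Ioo_mem_nhdsLT hpq
  have htend : Tendsto (fun s => (p, s)) (𝓝[<] q)
      (𝓝[Set.Icc (1 : ℝ≥0∞) ∞ ×ˢ Set.Icc (1 : ℝ≥0∞) ∞] (p, q)) := by
    refine tendsto_nhdsWithin_iff.2 ⟨?_, hIoo.mono fun s hs => hmem s hs.1⟩
    exact ((continuous_const.prodMk continuous_id).tendsto q).mono_left nhdsWithin_le_nhds
  have : (𝓝[<] q).NeBot := nhdsLT_neBot_of_exists_lt ⟨_, hpq⟩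
  obtain ⟨s, hs1, hs2⟩ := ((htend.eventually hconj).and hIoo).exists
  exact ⟨s, (bot_lt_of_lt hs2.1).ne', hs2.2, hbdd s hs2.1 hs1⟩

end Exponents

/-! ### Weak convergence and local compactness -/

section Limits

variable {d : ℕ} {p q : ℝ≥0∞} [Fact (1 ≤ p)] {ι : Type*}

theorem exists_tendsto_of_not_tendsto_cocompact {U : Ultrafilter ι} {w : ι → Space d}
    (h : ¬Tendsto w U (cocompact (Space d))) : ∃ z, Tendsto w U (𝓝 z) := by
  rw [hasBasis_cocompact.tendsto_right_iff] at h
  push Not at h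
  obtain ⟨K, hK, h⟩ := h
  have h1 : ∀ᶠ n in (U : Filter ι), w n ∈ K := by
    refine h.mono fun n hn => ?_
    simpa using hn
  obtain ⟨z, -, hz⟩ := hK.ultrafilter_le_nhds (U.map w) (le_principal_iff.2 h1)
  exact ⟨z, hz⟩

theorem tendsto_modulate {U : Filter ι} {g : ι → Lp ℂ p (surf d)} {φ : Lp ℂ p (surf d)}
    {w : ι → Space d} {z : Space d} (hg : Tendsto g U (𝓝 φ)) (hw : Tendsto w U (𝓝 z)) :
    Tendsto (fun n => modulate (w n) (g n)) U (𝓝 (modulate z φ)) := by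
  rw [tendsto_iff_norm_sub_tendsto_zero] at hg hw ⊢
  have h := hg.add (hw.mul_const ‖φ‖)
  rw [zero_mul, add_zero] at h
  refine squeeze_zero (fun _ => norm_nonneg _) (fun n => ?_) h
  calc ‖modulate (w n) (g n) - modulate z φ‖
      = ‖modulate (w n) (g n - φ) + (modulate (w n) φ - modulate z φ)‖ := by
        rw [modulate_sub]
        congr 1
        abel
    _ ≤ ‖g n - φ‖ + ‖w n - z‖ * ‖φ‖ := by
        refine (norm_add_le _ _).trans ?_
        rw [norm_modulate]
        gcongr
        exact norm_modulate_sub_le _ _ _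

theorem WeakTendsto.modulate {U : Filter ι} {g : ι → Lp ℂ p (surf d)} {φ : Lp ℂ p (surf d)}
    {w : ι → Space d} {z : Space d} {R : ℝ} (hg : WeakTendsto g U φ) (hR : ∀ n, ‖g n‖ ≤ R)
    (hw : Tendsto w U (𝓝 z)) :
    WeakTendsto (fun n => SphereExtension.modulate (w n) (g n)) U
      (SphereExtension.modulate z φ) := by
  refine (hg.map (modulateL z)).congr_of_tendsto_sub ?_
  rw [tendsto_iff_norm_sub_tendsto_zero] at hw
  rw [tendsto_zero_iff_norm_tendsto_zero]
  have h := hw.mul_const R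
  rw [zero_mul] at h
  refine squeeze_zero (fun _ => norm_nonneg _) (fun n => ?_) h
  refine (norm_modulate_sub_le _ _ _).trans ?_
  gcongr
  exact hR n

theorem eLpNorm_extend_modulate (y : Space d) (f : Lp ℂ p (surf d)) :
    eLpNorm (extend (modulate y f)) q volume = eLpNorm (extend f) q volume := by
  have h : extend (modulate y f) = extend f ∘ fun x => x + y := funext (extend_modulate y f)
  rw [h]
  exact eLpNorm_comp_measurePreserving (continuous_extend f).aestronglyMeasurable
    (measurePreserving_add_right volume y)

theorem extend_sub (f g : Lp ℂ p (surf d)) : extend (f - g : Lp ℂ p (surf d)) =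
    extend f - extend g := by
  ext x
  exact map_sub (extendAt x) f g

/-- Weak convergence in `L^p(S^d)` gives locally uniform convergence of the extensions. -/
theorem WeakTendsto.eventually_extend_close {U : Filter ι} [U.NeBot] {g : ι → Lp ℂ p (surf d)}
    {φ : Lp ℂ p (surf d)} (hg : WeakTendsto g U φ) (hg1 : ∀ n, ‖g n‖ ≤ 1) {K : Set (Space d)}
    (hK : IsCompact K) {η : ℝ} (hη : 0 < η) :
    ∀ᶠ n in U, ∀ x ∈ K, ‖extend (g n) x - extend φ x‖ ≤ η := by
  set L := embConst d p with hL
  have hL0 : 0 ≤ L := embConst_nonneg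
  have hρ : 0 < η / (4 * (L + 1)) := by positivity
  obtain ⟨t, -, ht, hcov⟩ := hK.finite_cover_balls hρ
  have hev : ∀ᶠ n in U, ∀ y ∈ t, ‖extend (g n) y - extend φ y‖ ≤ η / 2 := by
    refine (eventually_all_finite ht).2 fun y _ => ?_
    have h1 := tendsto_iff_norm_sub_tendsto_zero.1 (hg (extendAt y))
    filter_upwards [h1.eventually (gt_mem_nhds (by positivity : 0 < η / 2))] with n hn
    exact hn.le
  filter_upwards [hev] with n hn x hx
  obtain ⟨y, hy, hxy⟩ := Set.mem_iUnion₂.1 (hcov hx)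
  have hd : ‖x - y‖ ≤ η / (4 * (L + 1)) := by
    rw [← dist_eq_norm]
    exact (Metric.mem_ball.1 hxy).le
  have hlip : ∀ f : Lp ℂ p (surf d), ‖f‖ ≤ 1 → ‖extend f x - extend f y‖ ≤ η / 4 := by
    intro f hf
    calc _ ≤ L * ‖f‖ * ‖x - y‖ := norm_extend_Lp_sub_le f x y
      _ ≤ (L + 1) * 1 * (η / (4 * (L + 1))) := by gcongr; linarith
      _ = η / 4 := by field_simp
  have h1 := hlip (g n) (hg1 n)
  have h2 := hlip φ (hg.norm_le hg1)
  have h3 := hn y hy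
  have h4 : extend (g n) x - extend φ x = (extend (g n) x - extend (g n) y) +
      (extend (g n) y - extend φ y) - (extend φ x - extend φ y) := by ring
  rw [h4]
  calc _ ≤ ‖extend (g n) x - extend (g n) y‖ + ‖extend (g n) y - extend φ y‖ +
        ‖extend φ x - extend φ y‖ := (norm_sub_le _ _).trans (by gcongr; exact norm_add_le _ _)
    _ ≤ η := by linarith

theorem WeakTendsto.tendsto_eLpNorm_restrict {U : Filter ι} [U.NeBot] {g : ι → Lp ℂ p (surf d)}
    {φ : Lp ℂ p (surf d)} (hg : WeakTendsto g U φ) (hg1 : ∀ n, ‖g n‖ ≤ 1) {K : Set (Space d)}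
    (hK : IsCompact K) :
    Tendsto (fun n => eLpNorm (extend (g n) - extend φ) q (volume.restrict K)) U (𝓝 0) := by
  rw [ENNReal.tendsto_nhds_zero]
  intro ε hε
  set v : ℝ≥0∞ := volume.restrict K Set.univ ^ q.toReal⁻¹ with hv
  have hvt : v ≠ ∞ := by
    refine ENNReal.rpow_ne_top_of_nonneg (inv_nonneg.2 ENNReal.toReal_nonneg) ?_
    rw [Measure.restrict_apply_univ]
    exact hK.measure_lt_top.ne
  have hη : ∃ η : ℝ, 0 < η ∧ v * ENNReal.ofReal η ≤ ε := by
    have h1 : Tendsto (fun η : ℝ => v * ENNReal.ofReal η) (𝓝[>] 0)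
        (𝓝 (v * ENNReal.ofReal 0)) :=
      ENNReal.Tendsto.const_mul ((ENNReal.continuous_ofReal.tendsto 0).mono_left
        nhdsWithin_le_nhds) (Or.inr hvt)
    rw [ENNReal.ofReal_zero, mul_zero] at h1
    obtain ⟨η, h2, h3⟩ := ((h1.eventually (gt_mem_nhds hε)).and self_mem_nhdsWithin).exists
    exact ⟨η, h3, h2.le⟩
  obtain ⟨η, hη0, hη⟩ := hη
  filter_upwards [hg.eventually_extend_close hg1 hK hη0] with n hn
  refine (eLpNorm_le_of_ae_bound (C := η) ?_).trans hη
  exact (ae_restrict_iff' hK.measurableSet).2 (Eventually.of_forall fun x hx => hn x hx)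

theorem enorm_le_eLpNorm_top {F : Space d → ℂ} (hF : Continuous F) (x : Space d) :
    ‖F x‖ₑ ≤ eLpNorm F ∞ volume := by
  rw [eLpNorm_exponent_top]
  have hd : Dense {x | ‖F x‖ₑ ≤ eLpNormEssSup F volume} :=
    Measure.dense_of_ae (enorm_ae_le_eLpNormEssSup F volume)
  have hc : IsClosed {x | ‖F x‖ₑ ≤ eLpNormEssSup F volume} :=
    isClosed_le hF.enorm continuous_const
  have := hc.closure_eq ▸ hd x
  exact this

theorem exists_maximum_extend {s₀ : ℝ≥0∞} (hs0 : s₀ ≠ 0) (hs₀ : s₀ ≠ ∞) (hS : opNorm d p s₀ ≠ ∞)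
    (f : Lp ℂ p (surf d)) : ∃ y, ∀ x, ‖extend f x‖ ≤ ‖extend f y‖ := by
  by_cases h : ∀ x, extend f x = 0
  · exact ⟨0, fun x => by simp [h]⟩
  push Not at h
  obtain ⟨x₀, hx₀⟩ := h
  refine (continuous_extend f).norm.exists_forall_ge' x₀ ?_
  have h1 := (tendsto_extend_cocompact hs0 hs₀ hS f).norm
  rw [norm_zero] at h1
  filter_upwards [h1.eventually (gt_mem_nhds (norm_pos_iff.2 hx₀))] with x hx using hx.le

end Limits

/-! ### Exhaustion by profiles -/

section Exhaustion

variable {d : ℕ} {p q s : ℝ≥0∞} [Fact (1 ≤ p)]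

theorem exists_weakTendsto_modulate {ι : Type*} (hp1 : 1 < p) (hp : p ≠ ∞) (U : Ultrafilter ι)
    {f : ι → Lp ℂ p (surf d)} (hf : ∀ n, ‖f n‖ = 1) (y : ι → Space d) :
    ∃ φ, WeakTendsto (fun n => modulate (y n) (f n)) U φ :=
  have : UniformConvexSpace (Lp ℂ p (surf d)) := uniformConvexSpace_Lp hp1 hp
  exists_weakTendsto U (R := 1) fun n => by rw [norm_modulate, hf]

theorem exists_fin_cover {E : Type*} [Inhabited E] {N : ℕ} {t : Finset E} (ht : t.card ≤ N) :
    ∃ X : Fin N → E, ∀ y ∈ t, ∃ i, X i = y := by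
  refine ⟨fun i => if h : (i : ℕ) < t.card then (t.equivFin.symm ⟨i, h⟩ : E) else default,
    fun y hy => ?_⟩
  refine ⟨⟨t.equivFin ⟨y, hy⟩, (t.equivFin ⟨y, hy⟩).2.trans_le ht⟩, ?_⟩
  simp

/-- The part of the `L^q` norm that lives where `|F| < δ`. -/
theorem setLIntegral_small_le (hs0 : s ≠ 0) (hsq : s < q) (hq : q ≠ ∞) {F : Space d → ℂ}
    (hF : Continuous F) (δ : ℝ) :
    ∫⁻ x in {x | ‖F x‖ < δ}, ‖F x‖ₑ ^ q.toReal ≤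
      ENNReal.ofReal δ ^ (q.toReal - s.toReal) * eLpNorm F s volume ^ s.toReal := by
  have hs : s ≠ ∞ := hsq.ne_top
  have hsR : 0 < s.toReal := ENNReal.toReal_pos hs0 hs
  have hlt : s.toReal < q.toReal := (ENNReal.toReal_lt_toReal hs hq).2 hsq
  have hmeas : MeasurableSet {x | ‖F x‖ < δ} := (isOpen_lt hF.norm continuous_const).measurableSet
  have hc0 : ENNReal.ofReal δ ^ (q.toReal - s.toReal) ≠ ∞ :=
    ENNReal.rpow_ne_top_of_nonneg (by linarith) ENNReal.ofReal_ne_top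
  rw [eLpNorm_eq_lintegral_rpow_enorm_toReal hs0 hs, ← ENNReal.rpow_mul,
    one_div_mul_cancel hsR.ne', ENNReal.rpow_one, ← lintegral_const_mul' _ _ hc0]
  refine (setLIntegral_mono' hmeas fun x hx => ?_).trans (setLIntegral_le_lintegral _ _)
  have h1 : ‖F x‖ₑ ≤ ENNReal.ofReal δ := by
    rw [← ofReal_norm]
    exact ENNReal.ofReal_le_ofReal (le_of_lt hx)
  calc ‖F x‖ₑ ^ q.toReal = ‖F x‖ₑ ^ (q.toReal - s.toReal) * ‖F x‖ₑ ^ s.toReal := by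
        rw [← ENNReal.rpow_add_of_nonneg _ _ (by linarith) hsR.le, sub_add_cancel]
    _ ≤ _ := by gcongr

/-- Up to `ε`, an extremizing sequence is exhausted by finitely many diverging profiles. -/
theorem exists_profiles (hp1 : 1 < p) (hp : p ≠ ∞) (hs0 : s ≠ 0) (hsq : s < q) (hq1 : 1 ≤ q)
    (hq : q ≠ ∞) (hSs : opNorm d p s ≠ ∞) (hSq : opNorm d p q ≠ ∞) (U : Ultrafilter ℕ)
    {f : ℕ → Lp ℂ p (surf d)} (hf : ∀ n, ‖f n‖ = 1)
    (hlim : Tendsto (fun n => eLpNorm (extend (f n)) q volume) U (𝓝 (opNorm d p q)))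
    {ε : ℝ} (hε : 0 < ε) :
    ∃ (J : Type) (_ : Fintype J) (y : J → ℕ → Space d) (φ : J → Lp ℂ p (surf d)),
      DivergeAlong (U : Filter ℕ) y ∧
      (∀ j, WeakTendsto (fun n => modulate (y j n) (f n)) U (φ j)) ∧
      1 - ε ≤ ∑ j, ‖φ j‖ ^ q.toReal := by
  have hs : s ≠ ∞ := hsq.ne_top
  have hq0 : q ≠ 0 := (bot_lt_of_lt hsq).ne'
  have hsR : 0 < s.toReal := ENNReal.toReal_pos hs0 hs
  have hlt : s.toReal < q.toReal := (ENNReal.toReal_lt_toReal hs hq).2 hsq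
  set S := opNorm d p q with hS
  have hS0 : S ≠ 0 := (opNorm_pos hq0).ne'
  set Q := q.toReal with hQ
  have hQ0 : 0 < Q := by linarith
  have hf1 : ∀ n, ‖f n‖ₑ = 1 := fun n => by rw [← ofReal_norm, hf, ENNReal.ofReal_one]
  set C := opNorm d p s with hC
  have hFC : ∀ n, eLpNorm (extend (f n)) s volume ≤ C := fun n => by
    have := eLpNorm_extend_Lp_le (q := s) (f n)
    rwa [hf1, mul_one] at this
  -- choose the height `δ` below which little of the norm remains
  have hSQ0 : S ^ Q ≠ 0 := by simp [ENNReal.rpow_eq_zero_iff, hS0, hSq]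
  have hSQt : S ^ Q ≠ ∞ := ENNReal.rpow_ne_top_of_nonneg hQ0.le hSq
  have hδ : ∃ δ : ℝ, 0 < δ ∧
      ENNReal.ofReal δ ^ (Q - s.toReal) * C ^ s.toReal ≤ ENNReal.ofReal ε * S ^ Q := by
    have h1 : Tendsto (fun δ : ℝ => ENNReal.ofReal δ ^ (Q - s.toReal) * C ^ s.toReal) (𝓝[>] 0)
        (𝓝 (ENNReal.ofReal 0 ^ (Q - s.toReal) * C ^ s.toReal)) := by
      refine ENNReal.Tendsto.mul_const ?_
        (Or.inr (ENNReal.rpow_ne_top_of_nonneg hsR.le hSs))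
      exact ((ENNReal.continuous_rpow_const.comp ENNReal.continuous_ofReal).tendsto 0).mono_left
        nhdsWithin_le_nhds
    rw [ENNReal.ofReal_zero, ENNReal.zero_rpow_of_pos (by linarith), zero_mul] at h1
    have h2 : 0 < ENNReal.ofReal ε * S ^ Q :=
      ENNReal.mul_pos (by simpa using hε) hSQ0
    obtain ⟨δ, h3, h4⟩ := ((h1.eventually (gt_mem_nhds h2)).and self_mem_nhdsWithin).exists
    exact ⟨δ, h4, h3.le⟩
  obtain ⟨δ, hδ0, hδ⟩ := hδ
  obtain ⟨N, hN⟩ := exists_card_cover (d := d) hs0 hs hSs (L := embConst d p) embConst_nonneg hδ0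
  choose t htN ht using fun n => hN (extend (f n)) (continuous_extend _)
    (fun x y => by simpa [hf] using norm_extend_Lp_sub_le (f n) x y) (hFC n)
  choose X hX using fun n => exists_fin_cover (htN n)
  -- centers are equivalent when their difference converges along the ultrafilter
  let r : Setoid (Fin N) :=
    { r := fun i j => ∃ z, Tendsto (fun n => X n i - X n j) U (𝓝 z)
      iseqv :=
        { refl := fun i => ⟨0, by simp⟩
          symm := by
            rintro i j ⟨z, hz⟩
            refine ⟨-z, hz.neg.congr fun n => ?_⟩
            abel
          trans := by
            rintro i j k ⟨z, hz⟩ ⟨w, hw⟩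
            refine ⟨z + w, (hz.add hw).congr fun n => ?_⟩
            abel } }
  let J : Type := Quotient r
  let _ : Fintype J := Fintype.ofFinite J
  let y : J → ℕ → Space d := fun j n => X n j.out
  have hy : DivergeAlong (U : Filter ℕ) y := by
    intro j k hjk
    by_contra h
    have h1 := exists_tendsto_of_not_tendsto_cocompact h
    exact hjk (Quotient.out_equiv_out.1 h1)
  choose φ hφ using fun j => exists_weakTendsto_modulate hp1 hp U hf (y j)
  refine ⟨J, inferInstance, y, φ, hy, hφ, ?_⟩
  have hbd : ∃ R : ℝ, ∀ᶠ n in (U : Filter ℕ), ∀ i, ‖X n i - y ⟦i⟧ n‖ ≤ R := by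
    have h1 : ∀ i, ∃ z, Tendsto (fun n => X n i - y ⟦i⟧ n) U (𝓝 z) := fun i =>
      Setoid.symm (Quotient.mk_out (s := r) i)
    choose z hz using h1
    refine ⟨∑ i, (‖z i‖ + 1), eventually_all.2 fun i => ?_⟩
    filter_upwards [(hz i).norm.eventually (gt_mem_nhds (lt_add_one ‖z i‖))] with n hn
    exact hn.le.trans (Finset.single_le_sum (f := fun i => ‖z i‖ + 1)
      (fun i _ => by positivity) (Finset.mem_univ i))
  obtain ⟨R, hR⟩ := hbd
  set K : Set (Space d) := Metric.closedBall 0 (R + 1) with hK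
  have hKc : IsCompact K := isCompact_closedBall _ _
  have hφ1 : ∀ j n, ‖modulate (y j n) (f n)‖ ≤ 1 := fun j n => by rw [norm_modulate, hf]
  let e : J → ℕ → ℝ≥0∞ := fun j n =>
    eLpNorm (extend (modulate (y j n) (f n)) - extend (φ j)) q (volume.restrict K)
  have he : ∀ j, Tendsto (e j) U (𝓝 0) := fun j =>
    (hφ j).tendsto_eLpNorm_restrict (hφ1 j) hKc
  -- the part of the norm near the centers of one class
  have hball : ∀ j n, ∫⁻ x in Metric.closedBall (y j n) (R + 1), ‖extend (f n) x‖ₑ ^ Q ≤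
      (S * ‖φ j‖ₑ + e j n) ^ Q := by
    intro j n
    have hcont := continuous_extend (modulate (y j n) (f n))
    have h1 : ∫⁻ x in Metric.closedBall (y j n) (R + 1), ‖extend (f n) x‖ₑ ^ Q =
        ∫⁻ x in K, ‖extend (modulate (y j n) (f n)) x‖ₑ ^ Q := by
      have hpre : (fun x : Space d => x + y j n) ⁻¹' Metric.closedBall (y j n) (R + 1) = K := by
        ext x
        simp [hK, dist_eq_norm]
      have hmp := measurePreserving_add_right (volume : Measure (Space d)) (y j n)
      have h2 := hmp.setLIntegral_comp_preimage_emb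
        (measurableEmbedding_addRight (y j n)) (fun x => ‖extend (f n) x‖ₑ ^ Q)
        (Metric.closedBall (y j n) (R + 1))
      rw [hpre] at h2
      rw [← h2]
      simp only [extend_modulate]
    have h3 : ∫⁻ x in K, ‖extend (modulate (y j n) (f n)) x‖ₑ ^ Q =
        eLpNorm (extend (modulate (y j n) (f n))) q (volume.restrict K) ^ Q := by
      rw [eLpNorm_eq_lintegral_rpow_enorm_toReal hq0 hq, ← ENNReal.rpow_mul,
        one_div_mul_cancel hQ0.ne', ENNReal.rpow_one]
    rw [h1, h3]
    refine ENNReal.rpow_le_rpow ?_ hQ0.le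
    have h4 : extend (modulate (y j n) (f n)) =
        extend (φ j) + (extend (modulate (y j n) (f n)) - extend (φ j)) := by abel
    have h5 : eLpNorm (extend (φ j)) q (volume.restrict K) ≤ S * ‖φ j‖ₑ :=
      (eLpNorm_mono_measure _ Measure.restrict_le_self).trans (eLpNorm_extend_Lp_le (φ j))
    rw [h4]
    refine (eLpNorm_add_le (continuous_extend _).aestronglyMeasurable
      (hcont.sub (continuous_extend _)).aestronglyMeasurable hq1).trans ?_
    exact add_le_add h5 le_rfl
  have hupper : ∀ᶠ n in (U : Filter ℕ), eLpNorm (extend (f n)) q volume ^ Q ≤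
      ENNReal.ofReal ε * S ^ Q + ∑ j, (S * ‖φ j‖ₑ + e j n) ^ Q := by
    filter_upwards [hR] with n hn
    have hcov : (Set.univ : Set (Space d)) ⊆ {x | ‖extend (f n) x‖ < δ} ∪
        ⋃ j, Metric.closedBall (y j n) (R + 1) := by
      intro x _
      rcases lt_or_ge ‖extend (f n) x‖ δ with h | h
      · exact Or.inl h
      · right
        obtain ⟨w, hw, hxw⟩ := ht n x h
        obtain ⟨i, rfl⟩ := hX n w hw
        refine Set.mem_iUnion.2 ⟨⟦i⟧, ?_⟩
        rw [Metric.mem_closedBall]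
        have h1 := hn i
        rw [← dist_eq_norm] at h1
        linarith [dist_triangle x (X n i) (y ⟦i⟧ n)]
    rw [eLpNorm_eq_lintegral_rpow_enorm_toReal hq0 hq, ← ENNReal.rpow_mul,
      one_div_mul_cancel hQ0.ne', ENNReal.rpow_one]
    calc ∫⁻ x, ‖extend (f n) x‖ₑ ^ Q
        ≤ ∫⁻ x in {x | ‖extend (f n) x‖ < δ} ∪
            ⋃ j, Metric.closedBall (y j n) (R + 1),
            ‖extend (f n) x‖ₑ ^ Q := by
          rw [← setLIntegral_univ]
          exact lintegral_mono_set hcov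
      _ ≤ (∫⁻ x in {x | ‖extend (f n) x‖ < δ}, ‖extend (f n) x‖ₑ ^ Q) +
            ∑ j, ∫⁻ x in Metric.closedBall (y j n) (R + 1), ‖extend (f n) x‖ₑ ^ Q := by
          refine (lintegral_union_le _ _ _).trans (add_le_add le_rfl ?_)
          refine (lintegral_iUnion_le _ _).trans_eq ?_
          rw [tsum_fintype]
      _ ≤ _ := by
          refine add_le_add ?_ (Finset.sum_le_sum fun j _ => hball j n)
          · refine (setLIntegral_small_le hs0 hsq hq (continuous_extend _) δ).trans
              (le_trans ?_ hδ)
            gcongr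
            exact hFC n
  have hlim1 : Tendsto (fun n => eLpNorm (extend (f n)) q volume ^ Q) U (𝓝 (S ^ Q)) :=
    (ENNReal.continuous_rpow_const.tendsto S).comp hlim
  have hlim2 : Tendsto (fun n => ENNReal.ofReal ε * S ^ Q + ∑ j, (S * ‖φ j‖ₑ + e j n) ^ Q) U
      (𝓝 (ENNReal.ofReal ε * S ^ Q + ∑ j, (S * ‖φ j‖ₑ + 0) ^ Q)) := by
    refine tendsto_const_nhds.add (tendsto_finsetSum _ fun j _ => ?_)
    exact (ENNReal.continuous_rpow_const.tendsto _).comp (tendsto_const_nhds.add (he j))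
  have hfinal := le_of_tendsto_of_tendsto hlim1 hlim2 hupper
  have h1 : ∑ j, (S * ‖φ j‖ₑ + 0) ^ Q = ENNReal.ofReal (∑ j, ‖φ j‖ ^ Q) * S ^ Q := by
    rw [ENNReal.ofReal_sum_of_nonneg fun j _ => by positivity, Finset.sum_mul]
    refine Finset.sum_congr rfl fun j _ => ?_
    rw [add_zero, ENNReal.mul_rpow_of_nonneg _ _ hQ0.le, mul_comm, ← ofReal_norm,
      ENNReal.ofReal_rpow_of_nonneg (norm_nonneg _) hQ0.le]
  have hsum0 : 0 ≤ ∑ j, ‖φ j‖ ^ Q := Finset.sum_nonneg fun j _ => by positivity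
  rw [h1, ← add_mul, ← ENNReal.ofReal_add hε.le hsum0] at hfinal
  have h2 : (1 : ℝ≥0∞) ≤ ENNReal.ofReal (ε + ∑ j, ‖φ j‖ ^ Q) := by
    have h3 : 1 * S ^ Q ≤ ENNReal.ofReal (ε + ∑ j, ‖φ j‖ ^ Q) * S ^ Q := by rwa [one_mul]
    exact (ENNReal.mul_le_mul_iff_left hSQ0 hSQt).1 h3
  rw [ENNReal.one_le_ofReal] at h2
  linarith

end Exhaustion

/-! ### Convergence of extremizing sequences -/

section Convergence

variable {d : ℕ} {p q s : ℝ≥0∞} [Fact (1 ≤ p)]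

/-- Some profile of an extremizing sequence has norm arbitrarily close to `1`, because
`∑ ‖φ_j‖ ^ q` is almost `1` while `∑ ‖φ_j‖ ^ τ ≤ 1` for an exponent `τ < q`. -/
theorem exists_large_profile (hp1 : 1 < p) (hpq : p < q) (hpq' : p.conjExponent < q) (hs0 : s ≠ 0)
    (hsq : s < q) (hq : q ≠ ∞) (hSs : opNorm d p s ≠ ∞) (hSq : opNorm d p q ≠ ∞) (U : Ultrafilter ℕ)
    {f : ℕ → Lp ℂ p (surf d)} (hf : ∀ n, ‖f n‖ = 1)
    (hlim : Tendsto (fun n => eLpNorm (extend (f n)) q volume) U (𝓝 (opNorm d p q)))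
    {κ : ℝ} (hκ0 : 0 < κ) (hκ1 : κ < 1) :
    ∃ (y : ℕ → Space d) (φ : Lp ℂ p (surf d)),
      WeakTendsto (fun n => modulate (y n) (f n)) U φ ∧ κ ≤ ‖φ‖ := by
  have hp : p ≠ ∞ := hpq.ne_top
  obtain ⟨τ, hτ⟩ : ∃ τ, τ = max p.toReal p.conjExponent.toReal := ⟨_, rfl⟩
  have hτq : τ < q.toReal := by
    rw [hτ]
    exact max_lt ((ENNReal.toReal_lt_toReal hp hq).2 hpq)
      ((ENNReal.toReal_lt_toReal (conjExponent_ne_top hp1) hq).2 hpq')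
  have hτ0 : 0 < τ := by
    rw [hτ]
    exact lt_max_of_lt_left (by linarith [one_lt_toReal hp1 hp])
  have hc1 : κ ^ (q.toReal - τ) < 1 := Real.rpow_lt_one hκ0.le hκ1 (by linarith)
  obtain ⟨J, hJ, y, φ, hy, hφ, hsum⟩ := exists_profiles hp1 hp hs0 hsq (hp1.le.trans hpq.le) hq
    hSs hSq U hf hlim (ε := (1 - κ ^ (q.toReal - τ)) / 2) (by linarith)
  have hτsum := sum_norm_rpow_le_one hs0 hsq.ne_top hSs hp1 hp hy (fun n => (hf n).le) hφ hτ
  by_contra! h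
  have hle : ∑ j, ‖φ j‖ ^ q.toReal ≤ κ ^ (q.toReal - τ) * ∑ j, ‖φ j‖ ^ τ := by
    rw [Finset.mul_sum]
    refine Finset.sum_le_sum fun j _ => ?_
    calc ‖φ j‖ ^ q.toReal = ‖φ j‖ ^ (q.toReal - τ) * ‖φ j‖ ^ τ := by
          rw [← Real.rpow_add_of_nonneg (norm_nonneg _) (by linarith) hτ0.le, sub_add_cancel]
      _ ≤ _ := by
          gcongr
          exact (h (y j) (φ j) (hφ j)).le
  have hle' : κ ^ (q.toReal - τ) * ∑ j, ‖φ j‖ ^ τ ≤ κ ^ (q.toReal - τ) * 1 := by gcongr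
  linarith

/-- As two profiles with `‖φ‖ ^ τ > 1 / 2` agree up to a modulation, a single profile has norm at
least every number below `1`. -/
theorem exists_profile_norm_ge_one_of_ne_top (hp1 : 1 < p) (hpq : p < q)
    (hpq' : p.conjExponent < q) (hs0 : s ≠ 0)
    (hsq : s < q) (hq : q ≠ ∞) (hSs : opNorm d p s ≠ ∞) (hSq : opNorm d p q ≠ ∞) (U : Ultrafilter ℕ)
    {f : ℕ → Lp ℂ p (surf d)} (hf : ∀ n, ‖f n‖ = 1)
    (hlim : Tendsto (fun n => eLpNorm (extend (f n)) q volume) U (𝓝 (opNorm d p q))) :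
    ∃ (y : ℕ → Space d) (φ : Lp ℂ p (surf d)),
      WeakTendsto (fun n => modulate (y n) (f n)) U φ ∧ 1 ≤ ‖φ‖ := by
  have hp : p ≠ ∞ := hpq.ne_top
  obtain ⟨τ, hτ⟩ : ∃ τ, τ = max p.toReal p.conjExponent.toReal := ⟨_, rfl⟩
  have hτ0 : 0 < τ := by
    rw [hτ]
    exact lt_max_of_lt_left (by linarith [one_lt_toReal hp1 hp])
  set κ₀ : ℝ := (3 / 4) ^ (1 / τ) with hκ₀
  have hκ₀0 : 0 < κ₀ := by positivity
  have hκ₀1 : κ₀ < 1 := Real.rpow_lt_one (by norm_num) (by norm_num) (by positivity)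
  have hκ₀τ : κ₀ ^ τ = 3 / 4 := by
    rw [hκ₀, ← Real.rpow_mul (by norm_num), one_div_mul_cancel hτ0.ne', Real.rpow_one]
  obtain ⟨y₀, φ₀, hφ₀, hn₀⟩ := exists_large_profile hp1 hpq hpq' hs0 hsq hq hSs hSq U hf hlim
    hκ₀0 hκ₀1
  refine ⟨y₀, φ₀, hφ₀, le_of_forall_lt fun κ hκ => ?_⟩
  have hm1 : max ((κ + 1) / 2) κ₀ < 1 := max_lt (by linarith) hκ₀1
  obtain ⟨y, φ, hφ, hn⟩ := exists_large_profile hp1 hpq hpq' hs0 hsq hq hSs hSq U hf hlim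
    (lt_max_of_lt_right hκ₀0) hm1
  have hnot : ¬Tendsto (fun n => y n - y₀ n) U (cocompact (Space d)) := by
    intro hdiv
    have hdiv' : Tendsto (fun n => y₀ n - y n) U (cocompact (Space d)) := by
      have h1 : Tendsto (fun x : Space d => -x) (cocompact (Space d)) (cocompact (Space d)) :=
        (Homeomorph.neg (Space d)).isClosedEmbedding.tendsto_cocompact
      refine (h1.comp hdiv).congr fun n => ?_
      simp
    have hD : DivergeAlong (U : Filter ℕ) fun b : Bool => bif b then y else y₀ := by
      rintro (_ | _) (_ | _) h
      · exact absurd rfl h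
      · exact hdiv'
      · exact hdiv
      · exact absurd rfl h
    have h2 := sum_norm_rpow_le_one hs0 hsq.ne_top hSs hp1 hp hD (fun n => (hf n).le)
      (φ := fun b => bif b then φ else φ₀) (by rintro (_ | _) <;> assumption) hτ
    simp only [Fintype.univ_bool, Finset.mem_singleton, Bool.true_eq_false, not_false_eq_true,
      Finset.sum_insert, Finset.sum_singleton, cond_true, cond_false] at h2
    have h3 : κ₀ ^ τ ≤ ‖φ₀‖ ^ τ := by gcongr
    have h4 : κ₀ ^ τ ≤ ‖φ‖ ^ τ := by
      have := (le_max_right ((κ + 1) / 2) κ₀).trans hn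
      gcongr
    linarith
  obtain ⟨z, hz⟩ := exists_tendsto_of_not_tendsto_cocompact hnot
  have h1 : WeakTendsto (fun n => modulate (y n) (f n)) (U : Filter ℕ) (modulate z φ₀) := by
    have h2 := hφ₀.modulate (R := 1) (fun n => by rw [norm_modulate, hf]) hz
    simpa only [modulate_modulate, sub_add_cancel] using h2
  have h3 : ‖φ‖ = ‖φ₀‖ := by rw [hφ.unique h1, norm_modulate]
  have h4 := (le_max_left ((κ + 1) / 2) κ₀).trans hn
  linarith

/-- For `q = ∞` the weak limit is taken after the maximum of `|ℰ f_n|` is moved to the origin: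
evaluation at `0` is weakly continuous, so `S ≤ |ℰ φ(0)| ≤ S ‖φ‖`. -/
theorem exists_profile_norm_ge_one_top (hp1 : 1 < p) (hp : p ≠ ∞) (hs0 : s ≠ 0) (hs : s ≠ ∞)
    (hSs : opNorm d p s ≠ ∞) (hS : opNorm d p ∞ ≠ ∞) (U : Ultrafilter ℕ)
    {f : ℕ → Lp ℂ p (surf d)} (hf : ∀ n, ‖f n‖ = 1)
    (hlim : Tendsto (fun n => eLpNorm (extend (f n)) ∞ volume) U (𝓝 (opNorm d p ∞))) :
    ∃ (y : ℕ → Space d) (φ : Lp ℂ p (surf d)),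
      WeakTendsto (fun n => modulate (y n) (f n)) U φ ∧ 1 ≤ ‖φ‖ := by
  choose y hy using fun n => exists_maximum_extend hs0 hs hSs (f n)
  obtain ⟨φ, hφ⟩ := exists_weakTendsto_modulate hp1 hp U hf y
  refine ⟨y, φ, hφ, ?_⟩
  have h1 : Tendsto (fun n => ‖extend (f n) (y n)‖ₑ) U (𝓝 ‖extend φ 0‖ₑ) := by
    have h2 := (continuous_enorm.tendsto _).comp (hφ (extendAt 0))
    refine h2.congr fun n => ?_
    rw [Function.comp_apply, extendAt_apply, extend_modulate, zero_add]
  have h3 : opNorm d p ∞ ≤ ‖extend φ 0‖ₑ := by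
    refine le_of_tendsto_of_tendsto' hlim h1 fun n => ?_
    rw [eLpNorm_exponent_top]
    refine eLpNormEssSup_le_of_ae_enorm_bound (Eventually.of_forall fun x => ?_)
    rw [← ofReal_norm, ← ofReal_norm]
    exact ENNReal.ofReal_le_ofReal (hy n x)
  have h4 : opNorm d p ∞ * 1 ≤ opNorm d p ∞ * ‖φ‖ₑ := by
    rw [mul_one]
    exact h3.trans ((enorm_le_eLpNorm_top (continuous_extend φ) 0).trans (eLpNorm_extend_Lp_le φ))
  have h5 : (1 : ℝ≥0∞) ≤ ‖φ‖ₑ :=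
    (ENNReal.mul_le_mul_iff_right (opNorm_pos ENNReal.top_ne_zero).ne' hS).1 h4
  rwa [← ofReal_norm, ENNReal.one_le_ofReal] at h5

/-- Along any ultrafilter, an extremizing sequence converges after modulation, and the limit is an
extremizer. -/
theorem exists_tendsto_modulate (hp1 : 1 < p) (hpq : p < q) (hpq' : p.conjExponent < q)
    (hs0 : s ≠ 0) (hsq : s < q) (hSs : opNorm d p s ≠ ∞) (hSq : opNorm d p q ≠ ∞)
    (U : Ultrafilter ℕ) {f : ℕ → Lp ℂ p (surf d)} (hf : ∀ n, ‖f n‖ = 1)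
    (hlim : Tendsto (fun n => eLpNorm (extend (f n)) q volume) U (𝓝 (opNorm d p q))) :
    ∃ (y : ℕ → Space d) (φ : Lp ℂ p (surf d)),
      Tendsto (fun n => modulate (y n) (f n)) U (𝓝 φ) ∧ ‖φ‖ = 1 ∧
      eLpNorm (extend φ) q volume = opNorm d p q := by
  have hp : p ≠ ∞ := hpq.ne_top
  have : UniformConvexSpace (Lp ℂ p (surf d)) := uniformConvexSpace_Lp hp1 hp
  obtain ⟨y, φ, hφ, hφ1⟩ : ∃ (y : ℕ → Space d) (φ : Lp ℂ p (surf d)),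
      WeakTendsto (fun n => modulate (y n) (f n)) U φ ∧ 1 ≤ ‖φ‖ := by
    rcases eq_or_ne q ∞ with rfl | hq
    · exact exists_profile_norm_ge_one_top hp1 hp hs0 hsq.ne_top hSs hSq U hf hlim
    · exact exists_profile_norm_ge_one_of_ne_top hp1 hpq hpq' hs0 hsq hq hSs hSq U hf hlim
  have hn : ∀ n, ‖modulate (y n) (f n)‖ = 1 := fun n => by rw [norm_modulate, hf]
  have hstrong := hφ.tendsto (fun n => (hn n).le) hφ1
  have hnorm : ‖φ‖ = 1 := le_antisymm (hφ.norm_le fun n => (hn n).le) hφ1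
  refine ⟨y, φ, hstrong, hnorm, le_antisymm ?_ ?_⟩
  · have := eLpNorm_extend_Lp_le (q := q) φ
    rwa [← ofReal_norm, hnorm, ENNReal.ofReal_one, mul_one] at this
  · have h1 : Tendsto (fun n => eLpNorm (extend φ) q volume +
        opNorm d p q * ‖modulate (y n) (f n) - φ‖ₑ) U
        (𝓝 (eLpNorm (extend φ) q volume + opNorm d p q * 0)) := by
      refine tendsto_const_nhds.add (ENNReal.Tendsto.const_mul ?_ (Or.inr hSq))
      have h2 := (continuous_enorm.tendsto _).comp (hstrong.sub_const φ)
      rwa [sub_self, enorm_zero] at h2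
    rw [mul_zero, add_zero] at h1
    refine le_of_tendsto_of_tendsto' hlim h1 fun n => ?_
    rw [← eLpNorm_extend_modulate (y n)]
    have h3 : extend (modulate (y n) (f n)) = extend φ +
        extend (modulate (y n) (f n) - φ : Lp ℂ p (surf d)) := by
      rw [extend_sub]
      abel
    rw [h3]
    refine (eLpNorm_add_le (continuous_extend _).aestronglyMeasurable
      (continuous_extend _).aestronglyMeasurable (hp1.le.trans hpq.le)).trans ?_
    exact add_le_add le_rfl (eLpNorm_extend_Lp_le _)

/-- If some modulations of `f n` converge, then so do those that move a maximum of `|ℰ f_n|` to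
the origin: the two differ by bounded shifts as `ℰ φ` vanishes at infinity. -/
theorem exists_tendsto_modulate_of_maximum (hs0 : s ≠ 0) (hs : s ≠ ∞) (hSs : opNorm d p s ≠ ∞)
    {U : Ultrafilter ℕ} {f : ℕ → Lp ℂ p (surf d)} {x y : ℕ → Space d} {φ : Lp ℂ p (surf d)}
    (hx : ∀ n w, ‖extend (f n) w‖ ≤ ‖extend (f n) (x n)‖) (hφ0 : extend φ ≠ 0)
    (hy : Tendsto (fun n => modulate (y n) (f n)) U (𝓝 φ)) :
    ∃ ψ, Tendsto (fun n => modulate (x n) (f n)) U (𝓝 ψ) := by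
  have hnot : ¬Tendsto (fun n => x n - y n) U (cocompact (Space d)) := by
    intro hdiv
    obtain ⟨w, hw⟩ := Function.ne_iff.1 hφ0
    have h1 : Tendsto (fun n => ‖extend (modulate (y n) (f n)) w‖) U (𝓝 ‖extend φ w‖) :=
      (((extendAt w).continuous.tendsto φ).comp hy).norm
    have h2 : Tendsto (fun n => embConst d p * ‖modulate (y n) (f n) - φ‖ +
        ‖extend φ (x n - y n)‖) U (𝓝 (embConst d p * 0 + ‖(0 : ℂ)‖)) :=
      ((tendsto_iff_norm_sub_tendsto_zero.1 hy).const_mul _).add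
        ((tendsto_extend_cocompact hs0 hs hSs φ).comp hdiv).norm
    rw [mul_zero, norm_zero, add_zero] at h2
    have h3 := le_of_tendsto_of_tendsto' h1 h2 fun n => ?_
    · exact hw (norm_le_zero_iff.1 h3)
    · have h4 : extend (f n) (x n) = extend (modulate (y n) (f n)) (x n - y n) := by
        rw [extend_modulate, sub_add_cancel]
      have h5 : extend (modulate (y n) (f n)) (x n - y n) =
          extend (modulate (y n) (f n) - φ : Lp ℂ p (surf d)) (x n - y n) +
            extend φ (x n - y n) := by
        rw [extend_sub, Pi.sub_apply, sub_add_cancel]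
      rw [extend_modulate]
      refine (hx n _).trans ?_
      rw [h4, h5]
      refine (norm_add_le _ _).trans ?_
      gcongr
      exact norm_extend_Lp_le _ _
  obtain ⟨z, hz⟩ := exists_tendsto_of_not_tendsto_cocompact hnot
  refine ⟨modulate z φ, (tendsto_modulate hy hz).congr fun n => ?_⟩
  rw [modulate_modulate, sub_add_cancel]

theorem exists_extremizing_sequence (hq : q ≠ 0) :
    ∃ f : ℕ → Lp ℂ p (surf d), (∀ n, ‖f n‖ = 1) ∧
      Tendsto (fun n => eLpNorm (extend (f n)) q volume) atTop (𝓝 (opNorm d p q)) := by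
  let T : Set ℝ≥0∞ := {a | ∃ f : Lp ℂ p (surf d), ‖f‖ = 1 ∧ eLpNorm (extend f) q volume = a}
  have hT : opNorm d p q ≤ sSup T := by
    refine iSup_le fun f => iSup_le fun hf => iSup_le fun h1 => ?_
    refine le_sSup ⟨hf.toLp f, ?_, ?_⟩
    · rw [Lp.norm_toLp, h1, ENNReal.toReal_one]
    · rw [extend_congr_ae hf.coeFn_toLp]
  have hle : ∀ a ∈ T, a ≤ opNorm d p q := by
    rintro a ⟨f, hf, rfl⟩
    have := eLpNorm_extend_Lp_le (q := q) f
    rwa [← ofReal_norm, hf, ENNReal.ofReal_one, mul_one] at this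
  have hsup : sSup T = opNorm d p q := le_antisymm (sSup_le hle) hT
  have hne : T.Nonempty := by
    by_contra! h
    have := opNorm_pos (d := d) (p := p) hq
    rw [← hsup, h, sSup_empty] at this
    exact lt_irrefl _ this
  obtain ⟨u, -, hu, hmem⟩ := exists_seq_tendsto_sSup hne (OrderTop.bddAbove T)
  choose f hf1 hf2 using hmem
  refine ⟨f, hf1, ?_⟩
  rw [← hsup]
  exact hu.congr fun n => (hf2 n).symm

end Convergence

end SphereExtension

end

theorem theorem1 (d : ℕ) (hd : 1 ≤ d) (p q : ℝ≥0∞) [Fact (1 ≤ p)]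
    (hpq : max p (SphereExtension.scalingExponent d p) < q)
    (hconj : SphereExtension.ExtensionConjectureNear d p q) :
    (∀ f : ℕ → Lp ℂ p (SphereExtension.surf d),
      (∀ n, ‖f n‖ = 1) → SphereExtension.IsExtremizing p q f →
        ∃ x : ℕ → SphereExtension.Space d,
          IsCompact (closure (Set.range fun n => SphereExtension.modulate (x n) (f n)))) ∧
    ∃ f : Lp ℂ p (SphereExtension.surf d), SphereExtension.IsExtremizer p q f := by
  have hpltq : p < q := (le_max_left _ _).trans_lt hpq
  have hscq : SphereExtension.scalingExponent d p < q := (le_max_right _ _).trans_lt hpq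
  have hp : p ≠ ∞ := hpltq.ne_top
  have hp1 : 1 < p := SphereExtension.one_lt_of_scalingExponent_lt hscq
  have hp'q : p.conjExponent < q :=
    (SphereExtension.conjExponent_le_scalingExponent hd).trans_lt hscq
  have hq0 : q ≠ 0 := (bot_lt_of_lt hpltq).ne'
  obtain ⟨hSq, s, hs0, hsq, hSs⟩ :=
    SphereExtension.exists_opNorm_ne_top hd hp1 hp hpq hconj
  refine ⟨fun f hf hext => ?_, ?_⟩
  · have hlim : Tendsto (fun n => eLpNorm (SphereExtension.extend (f n)) q volume) atTop
        (𝓝 (SphereExtension.opNorm d p q)) := by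
      refine Tendsto.congr (fun n => ?_) hext
      rw [← Lp.enorm_def, ← ofReal_norm, hf, ENNReal.ofReal_one, div_one]
    -- maxima of `|ℰ f_n|` do not depend on the ultrafilter
    choose x hx using fun n => SphereExtension.exists_maximum_extend hs0 hsq.ne_top hSs (f n)
    refine ⟨x, ?_⟩
    refine (TotallyBounded.closure ?_).isCompact_of_isClosed isClosed_closure
    rw [totallyBounded_iff_ultrafilter]
    intro V hV
    set g : ℕ → Lp ℂ p (SphereExtension.surf d) := fun n =>
      SphereExtension.modulate (x n) (f n)
    have hrange : Set.range g ∈ (V : Filter _) := le_principal_iff.1 hV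
    have hne : (comap g V).NeBot := V.neBot.comap_of_range_mem hrange
    set U : Ultrafilter ℕ := Ultrafilter.of (comap g V)
    have hUV : Tendsto g U V := tendsto_comap.mono_left (Ultrafilter.of_le _)
    have hmap : map g U = V := V.unique hUV
    suffices h : ∃ ψ, Tendsto g U (𝓝 ψ) by
      obtain ⟨ψ, hψ⟩ := h
      rw [← hmap]
      exact hψ.cauchy_map
    -- along a principal `U` the sequence is constant; any other `U` contains the tails of `ℕ`
    rcases U.le_cofinite_or_eq_pure with hU1 | ⟨n, hn⟩
    · rw [Nat.cofinite_eq_atTop] at hU1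
      obtain ⟨y, φ, hy, -, hφ⟩ := SphereExtension.exists_tendsto_modulate hp1 hpltq hp'q hs0 hsq
        hSs hSq U hf (hlim.mono_left hU1)
      refine SphereExtension.exists_tendsto_modulate_of_maximum hs0 hsq.ne_top hSs hx ?_ hy
      intro h0
      rw [h0, eLpNorm_zero] at hφ
      exact (SphereExtension.opNorm_pos hq0).ne hφ
    · refine ⟨g n, ?_⟩
      rw [hn, Ultrafilter.coe_pure]
      exact tendsto_pure_nhds g n
  · obtain ⟨f, hf, hlim⟩ := SphereExtension.exists_extremizing_sequence (d := d) (p := p) hq0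
    obtain ⟨y, φ, -, hφ1, hφ⟩ := SphereExtension.exists_tendsto_modulate hp1 hpltq hp'q hs0 hsq
      hSs hSq (hyperfilter ℕ) hf (hlim.mono_left Nat.hyperfilter_le_atTop)
    refine ⟨φ, ?_, ?_⟩
    · intro h0
      rw [h0, norm_zero] at hφ1
      exact zero_ne_one hφ1
    · rw [hφ, ← Lp.enorm_def, ← ofReal_norm, hφ1, ENNReal.ofReal_one, mul_one]
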